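/- For a finitely generated group $K$ let $\mathrm{rk}(K)$ be the minimal number of generators of $K$ (and $\mathrm{rk}(K)=\infty$ if $K$ is not finitely generated). A subgroup $H\leqslant G$ is \emph{compressed in $G$} if $\mathrm{rk}(H)\leqslant \mathrm{rk}(K)$ for every finitely generated subgroup $K$ with $H\leqslant K\leqslant G$. Let $F_r$ be the free group of rank $r$, let $$S_g=\langle a_1,b_1,\ldots,a_g,b_g\mid [a_1,b_1]\cdots[a_g,b_g]\rangle ,\qquad NS_k=\langle a_1,\ldots,a_k\mid a_1^2\cdots a_k^2\rangle$$ be the fundamental groups of the closed orientable surface of genus $g$ and of the connected sum of $k$ projective planes, respectively, and for an automorphism $\phi$ of $G$ let $\mathrm{Fix}\,\phi=\{x\in G\mid \phi(x)=x\}$. **Theorem.** Let $G=G_1\times\cdots\times G_n$, $n\geqslant 1$, where each $G_i$ is isomorphic to $F_r$ for some $r\geqslant 1$, to $S_g$ for some $g\geqslant 1$, or to $NS_k$ for some $k\geqslant 1$. If $\mathrm{Fix}\,\phi$ is compressed in $G$ for every $\phi\in \mathrm{Aut}(G)$, then $G$ is isomorphic to a group of one of the following forms: - (euc1) $\mathbb{Z}^p\times(\mathbb{Z}/2\mathbb{Z})^q$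 for some $p,q\geqslant 0$; - (euc2) $NS_2\times(\mathbb{Z}/2\mathbb{Z})^q$ for some $q\geqslant 0$; - (euc3) $NS_2\times\mathbb{Z}^p\times\mathbb{Z}/2\mathbb{Z}$ for some $p\geqslant 1$; - (euc4) $NS_2^{\,\ell}\times\mathbb{Z}^p$ for some $\ell\geqslant 1$, $p\geqslant 0$; - (hyp1) $F_r\times NS_3^{\,\ell}$ for some $r\geqslant 2$, $\ell\geqslant 0$; - (hyp2) $S_g\times NS_3^{\,\ell}$ for some $g\geqslant 2$, $\ell\geqslant 0$; - (hyp3) $NS_k\times NS_3^{\,\ell}$ for some $k\geqslant 3$, $\ell\geqslant 0$. -/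

import Mathlib

/-- The relator `[a₁, b₁] ⋯ [a_g, b_g]`, where `a_i` is `Sum.inl i`, `b_i` is `Sum.inr i` and
`[x, y] = x * y * x⁻¹ * y⁻¹`. -/
def orientableRelator (g : ℕ) : FreeGroup (Fin g ⊕ Fin g) :=
  (List.ofFn fun i : Fin g =>
    FreeGroup.of (Sum.inl i) * FreeGroup.of (Sum.inr i) *
      (FreeGroup.of (Sum.inl i))⁻¹ * (FreeGroup.of (Sum.inr i))⁻¹).prod

/-- `S_g`: the fundamental group of the closed orientable surface of genus `g`. -/
abbrev OrientableSurfaceGroup (g : ℕ) : Type :=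
  PresentedGroup ({orientableRelator g} : Set (FreeGroup (Fin g ⊕ Fin g)))

/-- The relator `a₁² ⋯ a_k²`. -/
def nonorientableRelator (k : ℕ) : FreeGroup (Fin k) :=
  (List.ofFn fun i : Fin k => FreeGroup.of i ^ 2).prod

/-- `NS_k`: the fundamental group of the connected sum of `k` projective planes. -/
abbrev NonorientableSurfaceGroup (k : ℕ) : Type :=
  PresentedGroup ({nonorientableRelator k} : Set (FreeGroup (Fin k)))

/-- `A` is (isomorphic to) `F_r`, `S_g` or `NS_k` for some `r ≥ 1`, `g ≥ 1` or `k ≥ 1`. -/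
def IsFreeOrSurfaceGroup (A : Type*) [Group A] : Prop :=
  (∃ r : ℕ, 1 ≤ r ∧ Nonempty (A ≃* FreeGroup (Fin r))) ∨
  (∃ g : ℕ, 1 ≤ g ∧ Nonempty (A ≃* OrientableSurfaceGroup g)) ∨
  (∃ k : ℕ, 1 ≤ k ∧ Nonempty (A ≃* NonorientableSurfaceGroup k))

/-- The fixed subgroup `{x | φ x = x}` of an automorphism. -/
def fixSubgroup {G : Type*} [Group G] (φ : G ≃* G) : Subgroup G :=
  φ.toMonoidHom.eqLocus (MonoidHom.id G)

/-- `H` is compressed in `G`: `rk H ≤ rk K` for every finitely generated `K` with `H ≤ K ≤ G`.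
The rank of a group that is not finitely generated is infinite, so the inequality
`rk H ≤ rk K` with `K` finitely generated includes that `H` is finitely generated. -/
def IsCompressed {G : Type*} [Group G] (H : Subgroup G) : Prop :=
  ∀ (K : Subgroup G) [Group.FG K], H ≤ K →
    ∃ _ : Group.FG H, Group.rank H ≤ Group.rank K

/-- The infinite cyclic group, written multiplicatively. -/
abbrev CycInf : Type := Multiplicative ℤ

/-- The group of order two, written multiplicatively. -/
abbrev CycTwo : Type := Multiplicative (ZMod 2)

namespace FixCompressed

/-! ### Mod 2 ranks -/

/-! The contrapositive is proved: a product outside the list has an automorphism with an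
uncompressed fixed subgroup. A surjection of the fixed subgroup onto `(ℤ/2)^ι` bounds its rank from
below, and explicit generators bound the rank of an overgroup from above; `HasUncompressedFix`
records that the first number exceeds the second. Every free or surface group is tight, so an
obstruction on some factors extends by the identity to the others (`HasUncompressedFix.prod`), and a
few small obstructions suffice.

Hyperbolic times Euclidean. A hyperbolic factor `A` maps onto lamplighter groups. Position gives a
homomorphism `c` to the centre of the Euclidean factor `E`, and the shear `(a, e) ↦ (a, e * c a)`
has fixed subgroup `ker c × E`. If `c` has infinite image, `ker c` maps onto `(ℤ/2)^n` for every
`n`; if `E = ℤ/2`, a count of characters on a subgroup of index two is enough.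

Two main factors. The twist `t ↦ t * s` of a free group has fixed points inside the subgroup
generated by the `⟨t⟩`-conjugates of fewer elements than the mod 2 rank of the fixed subgroup. In `A
× B` the single pair `(t, u)` performs both conjugations: one generator is spent and two are saved.
On a surface group the twist acts on a one-holed torus or Klein bottle, combined with conjugation by
the boundary word on the rest; amalgam normal forms and rigidity of that word put all fixed points
into the one-holed piece (`mem_range_of_fixed`). This does not reach `NS₃`, where the rest is
infinite cyclic with boundary word `a²`, not rigid because `a` commutes with it.

Klein bottles. In `Klein × ℤ × (ℤ/2)²` and `Klein² × ℤ/2`, parity conditions cut out an abelian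
fixed subgroup of mod 2 rank five, while an overgroup in which `t` inverts `s` needs only four
generators.

An induction over the factors (`IsClassified.prod`) shows that a product without these obstructions
has one of the listed forms. -/

/-- The nontrivial element of the group of order two. -/
abbrev flip : CycTwo := Multiplicative.ofAdd 1

theorem cycTwo_eq (x : CycTwo) : x = 1 ∨ x = flip := by
  revert x; decide

theorem eq_top_of_mulSingle_mem {ι : Type*} [Finite ι] [DecidableEq ι] (H : Subgroup (ι → CycTwo))
    (h : ∀ i, Pi.mulSingle i flip ∈ H) : H = ⊤ := by
  have := Fintype.ofFinite ι
  rw [eq_top_iff]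
  intro f _
  rw [← Finset.univ_prod_mulSingle f]
  refine prod_mem fun i _ => ?_
  rcases cycTwo_eq (f i) with hi | hi
  · rw [hi, Pi.mulSingle_one]; exact one_mem _
  · rw [hi]; exact h i

theorem surjective_of_mulSingle {G ι : Type*} [Group G] [Finite ι] [DecidableEq ι]
    (χ : G →* (ι → CycTwo)) (h : ∀ i, ∃ g, χ g = Pi.mulSingle i flip) :
    Function.Surjective χ :=
  MonoidHom.range_eq_top.1 (eq_top_of_mulSingle_mem _ h)

/-- The images of a generating set span the vector space `(ZMod 2)^ι`, so there are at least `|ι|`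
generators. -/
theorem card_le_rank {G ι : Type*} [Group G] [Fintype ι] [Group.FG G]
    (χ : G →* (ι → CycTwo)) (hχ : Function.Surjective χ) :
    Fintype.card ι ≤ Group.rank G := by
  obtain ⟨S, hS, htop⟩ := Group.rank_spec G
  let v : G → (ι → ZMod 2) := fun g i => (χ g i).toAdd
  have hspan : Submodule.span (ZMod 2) ((S.image v : Finset (ι → ZMod 2)) : Set (ι → ZMod 2)) = ⊤ := by
    rw [eq_top_iff]
    rintro f -
    obtain ⟨g, hg⟩ := hχ (fun i => Multiplicative.ofAdd (f i))
    have hf : f = v g := by ext i; simp [v, hg]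
    rw [hf]
    have hmem : g ∈ Subgroup.closure (S : Set G) := by rw [htop]; trivial
    clear hf hg f
    induction hmem using Subgroup.closure_induction with
    | mem x hx => exact Submodule.subset_span (by simpa using ⟨x, hx, rfl⟩)
    | one =>
      have : v 1 = 0 := by ext i; simp [v]
      rw [this]; exact zero_mem _
    | mul x y _ _ hx hy =>
      have : v (x * y) = v x + v y := by ext i; simp [v]
      rw [this]; exact add_mem hx hy
    | inv x _ hx =>
      have : v x⁻¹ = -v x := by ext i; simp [v]
      rw [this]; exact neg_mem hx
  have h1 := finrank_span_finset_le_card (R := ZMod 2) (S.image v)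
  rw [Set.finrank, hspan, finrank_top, Module.finrank_fintype_fun_eq_card] at h1
  exact h1.trans (Finset.card_image_le.trans hS.le)

/-! ### Uncompressed fixed subgroups and tight groups -/

/-- Some automorphism of `G` has a fixed subgroup which maps onto `(ℤ/2)^ι` and is contained in a
subgroup with fewer than `|ι|` generators. -/
def HasUncompressedFix (G : Type*) [Group G] : Prop :=
  ∃ (φ : G ≃* G) (ι : Type) (_ : Fintype ι) (χ : fixSubgroup φ →* (ι → CycTwo)) (S : Finset G),
    Function.Surjective χ ∧ fixSubgroup φ ≤ Subgroup.closure S ∧ S.card < Fintype.card ι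

theorem HasUncompressedFix.not_isCompressed {G : Type*} [Group G] (h : HasUncompressedFix G) :
    ¬ ∀ φ : G ≃* G, IsCompressed (fixSubgroup φ) := by
  obtain ⟨φ, ι, _, χ, S, hχ, hS, hlt⟩ := h
  intro hc
  obtain ⟨_, hr⟩ := hc φ (Subgroup.closure S) hS
  have h1 := card_le_rank χ hχ
  have h2 := Subgroup.rank_closure_finset_le_card S
  omega

/-- The number of generators of `G` equals the mod 2 rank of `G`. -/
def IsTight (G : Type*) [Group G] : Prop :=
  ∃ (ι : Type) (_ : Fintype ι) (χ : G →* (ι → CycTwo)) (S : Finset G),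
    Function.Surjective χ ∧ Subgroup.closure (S : Set G) = ⊤ ∧ S.card ≤ Fintype.card ι

theorem mem_fixSubgroup {G : Type*} [Group G] {φ : G ≃* G} {x : G} :
    x ∈ fixSubgroup φ ↔ φ x = x := Iff.rfl

theorem IsTight.of_mulEquiv {G H : Type*} [Group G] [Group H] (h : IsTight G) (e : G ≃* H) :
    IsTight H := by
  classical
  obtain ⟨ι, _, χ, S, hχ, hS, hc⟩ := h
  refine ⟨ι, inferInstance, χ.comp e.symm.toMonoidHom, S.image e, hχ.comp e.symm.surjective, ?_,
    Finset.card_image_le.trans hc⟩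
  have := congrArg (Subgroup.map e.toMonoidHom) hS
  rw [MonoidHom.map_closure, Subgroup.map_top_of_surjective _ e.surjective] at this
  simpa using this

theorem HasUncompressedFix.of_mulEquiv {G H : Type*} [Group G] [Group H]
    (h : HasUncompressedFix G) (e : G ≃* H) : HasUncompressedFix H := by
  classical
  obtain ⟨φ, ι, _, χ, S, hχ, hS, hc⟩ := h
  let ψ : H ≃* H := (e.symm.trans φ).trans e
  have hψ : ∀ x : H, x ∈ fixSubgroup ψ → e.symm x ∈ fixSubgroup φ := fun x hx => by
    have : e (φ (e.symm x)) = x := hx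
    rw [mem_fixSubgroup]
    apply e.injective
    rw [this, e.apply_symm_apply]
  let r : fixSubgroup ψ →* fixSubgroup φ :=
    (e.symm.toMonoidHom.comp (fixSubgroup ψ).subtype).codRestrict _ fun x => hψ x x.2
  have hr : Function.Surjective r := fun y => by
    refine ⟨⟨e y, ?_⟩, ?_⟩
    · have : φ y = y := y.2
      change e (φ (e.symm (e y))) = e y
      rw [e.symm_apply_apply, this]
    · apply Subtype.ext
      exact e.symm_apply_apply _
  refine ⟨ψ, ι, inferInstance, χ.comp r, S.image e, hχ.comp hr, fun x hx => ?_,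
    Finset.card_image_le.trans_lt hc⟩
  have h1 := Subgroup.mem_map_of_mem e.toMonoidHom (hS (hψ x hx))
  rw [MonoidHom.map_closure] at h1
  simpa using h1

theorem closure_prod_of_finset {G H : Type*} [Group G] [Group H] [DecidableEq G] [DecidableEq H]
    (S : Finset G) (T : Finset H) :
    (Subgroup.closure (S : Set G)).prod (Subgroup.closure (T : Set H)) ≤
      Subgroup.closure ((S.image (MonoidHom.inl G H) ∪ T.image (MonoidHom.inr G H) : Finset (G × H)) :
        Set (G × H)) := by
  rintro ⟨x, y⟩ ⟨hx, hy⟩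
  have h1 := Subgroup.mem_map_of_mem (MonoidHom.inl G H) hx
  have h2 := Subgroup.mem_map_of_mem (MonoidHom.inr G H) hy
  rw [MonoidHom.map_closure] at h1 h2
  have h3 : (x, y) = MonoidHom.inl G H x * MonoidHom.inr G H y := by simp
  rw [Finset.coe_union, Finset.coe_image, Finset.coe_image, h3]
  exact mul_mem (Subgroup.closure_mono Set.subset_union_left h1)
    (Subgroup.closure_mono Set.subset_union_right h2)

/-- Two homomorphisms to elementary abelian 2-groups, side by side. -/
def sumHom {G H ι κ : Type*} [Group G] [Group H] (χ : G →* (ι → CycTwo)) (ξ : H →* (κ → CycTwo)) :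
    G × H →* (ι ⊕ κ → CycTwo) :=
  MonoidHom.mk' (fun x => Sum.elim (χ x.1) (ξ x.2)) fun x y => by
    ext i; rcases i with i | i <;> simp

theorem sumHom_surjective {G H ι κ : Type*} [Group G] [Group H] {χ : G →* (ι → CycTwo)}
    {ξ : H →* (κ → CycTwo)} (h : Function.Surjective χ) (h' : Function.Surjective ξ) :
    Function.Surjective (sumHom χ ξ) := fun f => by
  obtain ⟨x, hx⟩ := h (f ∘ Sum.inl)
  obtain ⟨y, hy⟩ := h' (f ∘ Sum.inr)
  refine ⟨(x, y), ?_⟩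
  change Sum.elim (χ x) (ξ y) = f
  rw [hx, hy, Sum.elim_comp_inl_inr]

theorem IsTight.prod {G H : Type*} [Group G] [Group H] (hG : IsTight G) (hH : IsTight H) :
    IsTight (G × H) := by
  classical
  obtain ⟨ι, _, χ, S, hχ, hS, hc⟩ := hG
  obtain ⟨κ, _, ξ, T, hξ, hT, hc'⟩ := hH
  refine ⟨ι ⊕ κ, inferInstance, sumHom χ ξ, _, sumHom_surjective hχ hξ,
    top_le_iff.1 (le_trans ?_ (closure_prod_of_finset S T)), ?_⟩
  · rw [hS, hT, Subgroup.top_prod_top]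
  · rw [Fintype.card_sum]
    exact (Finset.card_union_le _ _).trans
      (add_le_add (Finset.card_image_le.trans hc) (Finset.card_image_le.trans hc'))

/-- The automorphism is extended by the identity on `H`. Tightness of `H` ensures that the upper
bound grows by no more than the lower one, so the inequality stays strict. -/
theorem HasUncompressedFix.prod {G H : Type*} [Group G] [Group H] (hG : HasUncompressedFix G)
    (hH : IsTight H) : HasUncompressedFix (G × H) := by
  classical
  obtain ⟨φ, ι, _, χ, S, hχ, hS, hc⟩ := hG
  obtain ⟨κ, _, ξ, T, hξ, hT, hc'⟩ := hH
  let ψ : G × H ≃* G × H := φ.prodCongr (MulEquiv.refl H)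
  have hψ : ∀ x : G × H, x ∈ fixSubgroup ψ → x.1 ∈ fixSubgroup φ := fun x hx =>
    congrArg Prod.fst (show ψ x = x from hx)
  let r : fixSubgroup ψ →* fixSubgroup φ × H :=
    (((MonoidHom.fst G H).comp (fixSubgroup ψ).subtype).codRestrict _ fun x => hψ x x.2).prod
      ((MonoidHom.snd G H).comp (fixSubgroup ψ).subtype)
  have hr : Function.Surjective r := fun y =>
    ⟨⟨(y.1, y.2), Prod.ext y.1.2 rfl⟩, rfl⟩
  refine ⟨ψ, ι ⊕ κ, inferInstance, (sumHom χ ξ).comp r, _, (sumHom_surjective hχ hξ).comp hr,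
    le_trans (fun x hx => ?_) (closure_prod_of_finset S T), ?_⟩
  · exact ⟨hS (hψ x hx), by rw [hT]; trivial⟩
  · rw [Fintype.card_sum]
    exact (Finset.card_union_le _ _).trans_lt
      (add_lt_add_of_lt_of_le (Finset.card_image_le.trans_lt hc) (Finset.card_image_le.trans hc'))

/-- A product over `Fin (n + 1)` splits off its first factor. -/
def piFinSucc {n : ℕ} (A : Fin (n + 1) → Type*) [∀ i, Group (A i)] :
    (∀ i, A i) ≃* A 0 × (∀ i : Fin n, A i.succ) where
  toFun f := (f 0, fun i => f i.succ)
  invFun p := Fin.cons p.1 p.2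
  left_inv f := Fin.cons_self_tail f
  right_inv _ := rfl
  map_mul' _ _ := rfl

theorem IsTight.of_subsingleton {G : Type*} [Group G] [Subsingleton G] : IsTight G :=
  ⟨Empty, inferInstance, 1, ∅, fun f => ⟨1, Subsingleton.elim _ _⟩, Subsingleton.elim _ _, by simp⟩

theorem IsTight.pi {n : ℕ} {A : Fin n → Type*} [∀ i, Group (A i)] (h : ∀ i, IsTight (A i)) :
    IsTight (∀ i, A i) := by
  induction n with
  | zero => exact IsTight.of_subsingleton
  | succ n ih => exact ((h 0).prod (ih fun i => h i.succ)).of_mulEquiv (piFinSucc A).symm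

end FixCompressed

namespace FixCompressed

/-! ### Lamplighter groups -/

/-- The unrestricted wreath product of `R` by `ℤ`, with lamps indexed by the ring `I`. -/
@[ext]
structure Lamp (I R : Type*) where
  /-- The state of the lamps. -/
  lamps : I → R
  /-- The position of the lamplighter. -/
  pos : ℤ

namespace Lamp

variable {I R : Type*}

/-- The element with lamps `f` and position `0`. -/
def light (f : I → R) : Lamp I R := ⟨f, 0⟩

@[simp] theorem lamps_light (f : I → R) : (light f).lamps = f := rfl
@[simp] theorem pos_light (f : I → R) : (light f).pos = 0 := rfl

variable [AddCommGroup R]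

instance : One (Lamp I R) := ⟨⟨0, 0⟩⟩

/-- Moving one step. -/
def step : Lamp I R := ⟨0, 1⟩

@[simp] theorem lamps_one : (1 : Lamp I R).lamps = 0 := rfl
@[simp] theorem pos_one : (1 : Lamp I R).pos = 0 := rfl
@[simp] theorem lamps_step : (step : Lamp I R).lamps = 0 := rfl
@[simp] theorem pos_step : (step : Lamp I R).pos = 1 := rfl

variable [CommRing I]

instance : Mul (Lamp I R) := ⟨fun a b => ⟨fun i => a.lamps i + b.lamps (i - a.pos), a.pos + b.pos⟩⟩
instance : Inv (Lamp I R) := ⟨fun a => ⟨fun i => -a.lamps (i + a.pos), -a.pos⟩⟩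

@[simp] theorem lamps_mul (a b : Lamp I R) (i : I) :
    (a * b).lamps i = a.lamps i + b.lamps (i - a.pos) := rfl
@[simp] theorem pos_mul (a b : Lamp I R) : (a * b).pos = a.pos + b.pos := rfl
@[simp] theorem lamps_inv (a : Lamp I R) (i : I) : a⁻¹.lamps i = -a.lamps (i + a.pos) := rfl
@[simp] theorem pos_inv (a : Lamp I R) : a⁻¹.pos = -a.pos := rfl

instance : Group (Lamp I R) :=
  Group.ofLeftAxioms
    (fun a b c => by
      ext i
      · simp [add_assoc, sub_sub]
      · simp [add_assoc])
    (fun a => by ext i <;> simp)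
    (fun a => by ext i <;> simp)

/-- The position as a homomorphism. -/
def posHom : Lamp I R →* Multiplicative ℤ :=
  MonoidHom.mk' (fun a => Multiplicative.ofAdd a.pos) fun _ _ => rfl

@[simp] theorem pos_zpow (a : Lamp I R) (n : ℤ) : (a ^ n).pos = n * a.pos := by
  have := map_zpow (posHom (I := I) (R := R)) a n
  have := congrArg Multiplicative.toAdd this
  simpa [posHom] using this

theorem step_zpow (n : ℤ) : (step : Lamp I R) ^ n = ⟨0, n⟩ := by
  induction n using Int.induction_on with
  | zero => rfl
  | succ n ih => rw [zpow_add_one, ih]; ext i <;> simp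
  | pred n ih => rw [zpow_sub_one, ih]; ext i <;> simp; ring

theorem light_zpow (f : I → R) (n : ℤ) : light f ^ n = light (n • f) := by
  induction n using Int.induction_on with
  | zero => rw [zpow_zero, zero_smul]; rfl
  | succ n ih =>
    rw [zpow_add_one, ih, add_smul, one_smul]; ext i <;> simp
  | pred n ih =>
    rw [zpow_sub_one, ih, sub_smul, one_smul]; ext i <;> simp [sub_eq_add_neg]

end Lamp

open Lamp

/-- The lamplighter group on `n` lamps with two states. -/
abbrev CycLamp (n : ℕ) : Type := Lamp (ZMod n) (ZMod 2)

/-- The lamp at `0` is lit. -/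
def spark {n : ℕ} : CycLamp n := light (Pi.single 0 1)

/-- The group `A` is generated by `|ι| + 2` elements and maps onto lamplighter groups times
`(ℤ/2)^ι`. -/
def IsLamplit (A : Type*) [Group A] : Prop :=
  ∃ (ι : Type) (_ : Fintype ι) (S : Finset A), Subgroup.closure (S : Set A) = ⊤ ∧
    S.card ≤ Fintype.card ι + 2 ∧ ∀ n : ℕ, ∃ f : A →* CycLamp n × (ι → CycTwo),
      (∃ x, f x = (step, 1)) ∧ (∃ x, f x = (spark, 1)) ∧ ∀ v, ∃ x, f x = (1, v)

theorem IsLamplit.of_mulEquiv {A B : Type*} [Group A] [Group B] (h : IsLamplit A) (e : A ≃* B) :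
    IsLamplit B := by
  classical
  obtain ⟨ι, _, S, hS, hc, hf⟩ := h
  refine ⟨ι, inferInstance, S.image e, ?_, Finset.card_image_le.trans hc, fun n => ?_⟩
  · have := congrArg (Subgroup.map e.toMonoidHom) hS
    rw [MonoidHom.map_closure, Subgroup.map_top_of_surjective _ e.surjective] at this
    simpa using this
  · obtain ⟨f, ⟨x, hx⟩, ⟨y, hy⟩, hv⟩ := hf n
    refine ⟨f.comp e.symm.toMonoidHom, ⟨e x, by simpa using hx⟩, ⟨e y, by simpa using hy⟩,
      fun v => ?_⟩
    obtain ⟨z, hz⟩ := hv v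
    exact ⟨e z, by simpa using hz⟩

/-- The automorphism `(a, e) ↦ (a, e * c a)` for a homomorphism `c` to the centre. -/
def shear {A E : Type*} [Group A] [Group E] (c : A →* E) (hc : ∀ a e, Commute (c a) e) :
    A × E ≃* A × E where
  toFun x := (x.1, x.2 * c x.1)
  invFun x := (x.1, x.2 * (c x.1)⁻¹)
  left_inv x := by simp
  right_inv x := by simp
  map_mul' x y := by
    ext
    · rfl
    · simp only [Prod.snd_mul, Prod.fst_mul, map_mul, mul_assoc]
      rw [← mul_assoc (c x.1) y.2, (hc x.1 y.2).eq]; simp only [mul_assoc]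

theorem mem_fixSubgroup_shear {A E : Type*} [Group A] [Group E] (c : A →* E)
    (hc : ∀ a e, Commute (c a) e) (x : A × E) : x ∈ fixSubgroup (shear c hc) ↔ c x.1 = 1 := by
  rw [mem_fixSubgroup]
  change (x.1, x.2 * c x.1) = x ↔ _
  rw [Prod.ext_iff]
  simp

theorem IsLamplit.isTight {A : Type*} [Group A] (h : IsLamplit A) : IsTight A := by
  classical
  obtain ⟨ι, _, S, hS, hc, hf⟩ := h
  -- With one lamp, its state and the parity of the position are two further characters, matching
  -- the `|ι| + 2` generators.
  obtain ⟨f, ⟨x, hx⟩, ⟨y, hy⟩, hv⟩ := hf 1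
  refine ⟨Bool ⊕ ι, inferInstance,
    MonoidHom.mk' (fun a => Sum.elim
      (fun b => cond b (Multiplicative.ofAdd ((f a).1.pos : ZMod 2))
        (Multiplicative.ofAdd ((f a).1.lamps 0))) (f a).2) ?_, S, ?_, hS, ?_⟩
  · intro a b
    ext i
    rcases i with (_ | _) | i
    · simp [Subsingleton.elim _ (0 : ZMod 1)]
    · simp
    · simp
  · refine surjective_of_mulSingle _ fun i => ?_
    rcases i with (_ | _) | i
    · refine ⟨y, funext fun j => ?_⟩
      rcases j with (_ | _) | j <;> simp [hy, spark]
    · refine ⟨x, funext fun j => ?_⟩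
      rcases j with (_ | _) | j <;> simp [hx]
    · obtain ⟨z, hz⟩ := hv (Pi.mulSingle i flip)
      refine ⟨z, funext fun j => ?_⟩
      rcases j with (_ | _) | j <;> simp [hz, Pi.mulSingle_apply]
  · simp only [Fintype.card_sum, Fintype.card_bool]; omega

/-- Steps carry the spark to every lamp; this is how fixed subgroups, confined to restricted
positions, still reach all lamp states. -/
theorem spark_conj {n : ℕ} (k : ℤ) :
    (step ^ k * spark * (step ^ k)⁻¹ : CycLamp n) = light (Pi.single (k : ZMod n) 1) := by
  rw [step_zpow]
  ext i
  · simp [spark, Pi.single_apply, sub_eq_zero]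
  · simp [spark]

/-- A lamplit group times a group with an infinite order central element. -/
theorem IsLamplit.hasUncompressedFix_prod_of_central {A E : Type*} [Group A] [Group E]
    (hA : IsLamplit A) (hE : IsTight E) (z : E) (hz : ∀ e, Commute z e)
    (hz' : ∀ k : ℤ, z ^ k = 1 → k = 0) : HasUncompressedFix (A × E) := by
  classical
  obtain ⟨κ, _, ξ, T, -, hT, -⟩ := hA.isTight.prod hE
  obtain ⟨ι, _, S, hS, -, hf⟩ := hA
  -- One lamp more than the generators `T` of the whole product. Fixed elements have position `0`,
  -- so their lamps add without a shift.
  obtain ⟨f, ⟨x, hx⟩, ⟨y, hy⟩, -⟩ := hf (T.card + 1)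
  let c : A →* E := ((zpowersHom E z).comp posHom).comp ((MonoidHom.fst _ _).comp f)
  have hc : ∀ a, c a = z ^ (f a).1.pos := fun a => rfl
  have hcc : ∀ a e, Commute (c a) e := fun a e => (hz e).zpow_left _
  have hpos : ∀ a : fixSubgroup (shear c hcc), (f a.1.1).1.pos = 0 := fun a =>
    hz' _ ((mem_fixSubgroup_shear c hcc a.1).1 a.2)
  refine ⟨shear c hcc, ZMod (T.card + 1), inferInstance,
    MonoidHom.mk' (fun a i => Multiplicative.ofAdd ((f a.1.1).1.lamps i)) fun a b => ?_, T, ?_,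
    by rw [hT]; exact le_top, by rw [ZMod.card]; omega⟩
  · ext i
    simp [hpos a]
  · refine surjective_of_mulSingle _ fun i => ?_
    obtain ⟨k, rfl⟩ := ZMod.intCast_surjective i
    have h1 : (f (x ^ k * y * (x ^ k)⁻¹)).1 = light (Pi.single (k : ZMod (T.card + 1)) 1) := by
      rw [← spark_conj]; simp [hx, hy]
    refine ⟨⟨(x ^ k * y * (x ^ k)⁻¹, 1), ?_⟩, ?_⟩
    · rw [mem_fixSubgroup_shear, hc, h1, pos_light, zpow_zero]
    · ext j
      simp only [MonoidHom.mk'_apply, h1, lamps_light]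
      by_cases hj : j = k
      · subst hj; simp
      · simp [hj]

/-- Makes half of an exponent a mod 2 character on a subgroup where that exponent is even. -/
theorem zmod_two_cast_half (a b : ℤ) (ha : (a : ZMod 2) = 0) :
    (((a + b) / 2 : ℤ) : ZMod 2) = ((a / 2 : ℤ) : ZMod 2) + ((b / 2 : ℤ) : ZMod 2) := by
  have ha : (2 : ℤ) ∣ a := (ZMod.intCast_zmod_eq_zero_iff_dvd a 2).1 ha
  rw [← Int.cast_add, Int.add_ediv_of_dvd_left ha]

/-- A lamplit group times a group of order two. -/
theorem IsLamplit.hasUncompressedFix_prod_cycTwo {A : Type*} [Group A]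
    (hA : IsLamplit A) : HasUncompressedFix (A × CycTwo) := by
  classical
  obtain ⟨ι, _, S, hS, hcard, hf⟩ := hA
  -- Fixed elements have even position, which does not shift two lamps. Two lamps, half the
  -- position, the `CycTwo` coordinate and `ι` make `|ι| + 4` characters, against at most `|ι| + 3`
  -- generators of the whole product.
  obtain ⟨f, ⟨x, hx⟩, ⟨y, hy⟩, hv⟩ := hf 2
  let c : A →* CycTwo := MonoidHom.mk' (fun a => Multiplicative.ofAdd ((f a).1.pos : ZMod 2))
    fun a b => by simp
  have hc : ∀ a, c a = Multiplicative.ofAdd ((f a).1.pos : ZMod 2) := fun a => rfl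
  have hcc : ∀ a e, Commute (c a) e := fun a e => Commute.all _ _
  have hpos : ∀ a : fixSubgroup (shear c hcc), ((f a.1.1).1.pos : ZMod 2) = 0 := fun a =>
    (mem_fixSubgroup_shear c hcc a.1).1 a.2
  let χ : fixSubgroup (shear c hcc) →* (ZMod 2 ⊕ (Bool ⊕ ι) → CycTwo) :=
    MonoidHom.mk' (fun a => Sum.elim (fun i => Multiplicative.ofAdd ((f a.1.1).1.lamps i))
      (Sum.elim (fun b => cond b a.1.2
        (Multiplicative.ofAdd (((f a.1.1).1.pos / 2 : ℤ) : ZMod 2))) (f a.1.1).2)) fun a b => by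
      ext i
      rcases i with i | (_ | _) | i
      · simp [hpos a]
      · simp [zmod_two_cast_half _ _ (hpos a)]
      · simp
      · simp
  have hχ : ∀ a, χ a = Sum.elim (fun i => Multiplicative.ofAdd ((f a.1.1).1.lamps i))
      (Sum.elim (fun b => cond b a.1.2
        (Multiplicative.ofAdd (((f a.1.1).1.pos / 2 : ℤ) : ZMod 2))) (f a.1.1).2) := fun _ => rfl
  refine ⟨shear c hcc, ZMod 2 ⊕ (Bool ⊕ ι), inferInstance, χ,
    S.image (MonoidHom.inl A CycTwo) ∪ ({flip} : Finset CycTwo).image (MonoidHom.inr A CycTwo), 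
    ?_, ?_, ?_⟩
  · refine surjective_of_mulSingle _ fun i => ?_
    rcases i with i | (_ | _) | i
    · obtain ⟨k, rfl⟩ := ZMod.intCast_surjective i
      have h1 : f (x ^ k * y * (x ^ k)⁻¹) = (light (Pi.single (k : ZMod 2) 1), 1) := by
        rw [← spark_conj]; simp [hx, hy]
      refine ⟨⟨(x ^ k * y * (x ^ k)⁻¹, 1), ?_⟩, ?_⟩
      · rw [mem_fixSubgroup_shear, hc, h1, pos_light]; rfl
      · rw [hχ]
        ext j
        rcases j with j | (_ | _) | j
        · by_cases hj : j = k
          · subst hj; simp [h1]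
          · simp [hj, h1]
        all_goals simp [h1]
    · obtain ⟨u, h1⟩ : ∃ u, f u = (⟨0, 2⟩, 1) := by
        refine ⟨x ^ (2 : ℤ), ?_⟩
        rw [← step_zpow, map_zpow, hx]; simp
      refine ⟨⟨(u, 1), ?_⟩, ?_⟩
      · rw [mem_fixSubgroup_shear, hc, h1]
        exact congrArg Multiplicative.ofAdd (by decide : ((2 : ℤ) : ZMod 2) = 0)
      · rw [hχ]
        ext j
        rcases j with j | (_ | _) | j <;> simp [h1]
    · refine ⟨⟨(1, flip), ?_⟩, ?_⟩
      · rw [mem_fixSubgroup_shear, map_one]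
      · rw [hχ]
        ext j
        rcases j with j | (_ | _) | j <;> simp
    · obtain ⟨w, hw⟩ := hv (Pi.mulSingle i flip)
      refine ⟨⟨(w, 1), ?_⟩, ?_⟩
      · rw [mem_fixSubgroup_shear, hc, hw]; rfl
      · rw [hχ]
        ext j
        rcases j with j | (_ | _) | j <;> simp [hw, Pi.mulSingle_apply]
  · refine le_trans ?_ (closure_prod_of_finset S {flip})
    rw [hS]
    intro a _
    refine ⟨trivial, ?_⟩
    rcases cycTwo_eq a.2 with h | h
    · rw [h]; exact one_mem _
    · rw [h]; exact Subgroup.subset_closure (by simp)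
  · have h1 := Finset.card_union_le (S.image (MonoidHom.inl A CycTwo))
      (({flip} : Finset CycTwo).image (MonoidHom.inr A CycTwo))
    have h2 : (S.image (MonoidHom.inl A CycTwo)).card ≤ S.card := Finset.card_image_le
    simp only [Finset.image_singleton, Finset.card_singleton, Fintype.card_sum, ZMod.card,
      Fintype.card_bool] at h1 ⊢
    omega

end FixCompressed

namespace FixCompressed

open Lamp

/-! ### Free and surface groups as lamplit groups -/

theorem isLamplit_of_generators {A κ ι : Type} [Group A] [Fintype κ] [Fintype ι] [DecidableEq ι]
    (u : κ → A) (hu : Subgroup.closure (Set.range u) = ⊤)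
    (hcard : Fintype.card κ ≤ Fintype.card ι + 2)
    (h : ∀ n : ℕ, ∃ f : A →* CycLamp n × (ι → CycTwo),
      (∃ x, f x = (step, 1)) ∧ (∃ x, f x = (spark, 1)) ∧ ∀ i, ∃ x, f x = (1, Pi.mulSingle i flip)) :
    IsLamplit A := by
  classical
  refine ⟨ι, inferInstance, Finset.univ.image u, by simpa using hu,
    Finset.card_image_le.trans hcard, fun n => ?_⟩
  obtain ⟨f, hx, hc, hi⟩ := h n
  refine ⟨f, hx, hc, fun v => ?_⟩
  have := eq_top_of_mulSingle_mem (f.range.comap (MonoidHom.inr (CycLamp n) (ι → CycTwo))) hi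
  have hv : v ∈ f.range.comap (MonoidHom.inr (CycLamp n) (ι → CycTwo)) := by rw [this]; trivial
  exact hv

theorem isLamplit_freeGroup (m : ℕ) : IsLamplit (FreeGroup (Fin (m + 2))) := by
  refine isLamplit_of_generators (ι := Fin m) FreeGroup.of (FreeGroup.closure_range_of _) (by simp)
    fun n => ⟨FreeGroup.lift (Fin.cons (step, 1) (Fin.cons (spark, 1)
      fun i => (1, Pi.mulSingle i flip) : Fin (m + 1) → CycLamp n × (Fin m → CycTwo)) :
        Fin (m + 2) → CycLamp n × (Fin m → CycTwo)),
      ⟨FreeGroup.of 0, ?_⟩, ⟨FreeGroup.of (Fin.succ 0), ?_⟩,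
      fun i => ⟨FreeGroup.of i.succ.succ, ?_⟩⟩
  all_goals simp only [FreeGroup.lift_apply_of, Fin.cons_succ, Fin.cons_zero]

/-- The commutator, in the convention of `orientableRelator`. -/
abbrev comm {G : Type*} [Group G] (x y : G) : G := x * y * x⁻¹ * y⁻¹

theorem lift_orientableRelator {G : Type*} [Group G] {g : ℕ} (u : Fin g ⊕ Fin g → G) :
    FreeGroup.lift u (orientableRelator g) =
      (List.ofFn fun i => comm (u (Sum.inl i)) (u (Sum.inr i))).prod := by
  simp [orientableRelator, map_list_prod, List.map_ofFn, Function.comp_def]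

theorem lift_nonorientableRelator {G : Type*} [Group G] {k : ℕ} (u : Fin k → G) :
    FreeGroup.lift u (nonorientableRelator k) = (List.ofFn fun i => u i ^ 2).prod := by
  simp [nonorientableRelator, map_list_prod, List.map_ofFn, Function.comp_def]

theorem prod_ofFn_eq_one {G : Type*} [Group G] {k : ℕ} {u : Fin k → G} (h : ∀ i, u i = 1) :
    (List.ofFn u).prod = 1 := by
  rw [funext h]; simp

/-- A homomorphism from an orientable surface group. -/
def ofOrientable {G : Type*} [Group G] {g : ℕ} (u : Fin g ⊕ Fin g → G)
    (h : (List.ofFn fun i => comm (u (Sum.inl i)) (u (Sum.inr i))).prod = 1) :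
    OrientableSurfaceGroup g →* G :=
  PresentedGroup.toGroup (f := u) fun r hr => by
    rw [Set.mem_singleton_iff.1 hr, lift_orientableRelator, h]

@[simp] theorem ofOrientable_of {G : Type*} [Group G] {g : ℕ} (u : Fin g ⊕ Fin g → G) (h) (i) :
    ofOrientable u h (PresentedGroup.of i) = u i :=
  PresentedGroup.toGroup.of _

/-- A homomorphism from a nonorientable surface group. -/
def ofNonorientable {G : Type*} [Group G] {k : ℕ} (u : Fin k → G)
    (h : (List.ofFn fun i => u i ^ 2).prod = 1) : NonorientableSurfaceGroup k →* G :=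
  PresentedGroup.toGroup (f := u) fun r hr => by
    rw [Set.mem_singleton_iff.1 hr, lift_nonorientableRelator, h]

@[simp] theorem ofNonorientable_of {G : Type*} [Group G] {k : ℕ} (u : Fin k → G) (h) (i) :
    ofNonorientable u h (PresentedGroup.of i) = u i :=
  PresentedGroup.toGroup.of _

theorem orientable_relation (g : ℕ) :
    (List.ofFn fun i : Fin g => comm (PresentedGroup.of (Sum.inl i) : OrientableSurfaceGroup g)
      (PresentedGroup.of (Sum.inr i))).prod = 1 := by
  rw [← lift_orientableRelator (G := OrientableSurfaceGroup g) PresentedGroup.of]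
  have : FreeGroup.lift (PresentedGroup.of (rels := {orientableRelator g})) =
      PresentedGroup.mk {orientableRelator g} := by ext; simp; rfl
  rw [this]
  exact PresentedGroup.one_of_mem rfl

theorem nonorientable_relation (k : ℕ) :
    (List.ofFn fun i : Fin k => (PresentedGroup.of i : NonorientableSurfaceGroup k) ^ 2).prod
      = 1 := by
  rw [← lift_nonorientableRelator (G := NonorientableSurfaceGroup k) PresentedGroup.of]
  have : FreeGroup.lift (PresentedGroup.of (rels := {nonorientableRelator k})) =
      PresentedGroup.mk {nonorientableRelator k} := by ext; simp; rfl
  rw [this]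
  exact PresentedGroup.one_of_mem rfl

theorem comm_eq_one {G : Type*} [Group G] {x y : G} (h : Commute x y) : comm x y = 1 := by
  rw [comm, h.eq, mul_inv_cancel_right, mul_inv_cancel]

theorem cycTwo_fun_sq {ι : Type*} (v : ι → CycTwo) : v ^ 2 = 1 := by
  ext i
  rcases cycTwo_eq (v i) with h | h
  · simp [h]
  · have h' : flip ^ 2 = 1 := by decide
    rw [Pi.pow_apply, h, h', Pi.one_apply]

/-- All `b_i` go to the central factor, which kills every commutator and leaves the first two `a_i`
free to be the step and the spark. -/
theorem isLamplit_orientable (m : ℕ) : IsLamplit (OrientableSurfaceGroup (m + 2)) := by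
  let u (n : ℕ) : Fin (m + 2) → CycLamp n × (Fin m ⊕ Fin (m + 2) → CycTwo) :=
    Fin.cons (step, 1) (Fin.cons (spark, 1) fun i => (1, Pi.mulSingle (Sum.inl i) flip) :
      Fin (m + 1) → CycLamp n × (Fin m ⊕ Fin (m + 2) → CycTwo))
  let v (n : ℕ) : Fin (m + 2) → CycLamp n × (Fin m ⊕ Fin (m + 2) → CycTwo) :=
    fun i => (1, Pi.mulSingle (Sum.inr i) flip)
  refine isLamplit_of_generators (ι := Fin m ⊕ Fin (m + 2)) PresentedGroup.of
    (PresentedGroup.closure_range_of _) (by simp; omega)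
    fun n => ⟨ofOrientable (Sum.elim (u n) (v n)) ?_,
      ⟨PresentedGroup.of (Sum.inl 0), ?_⟩, ⟨PresentedGroup.of (Sum.inl (Fin.succ 0)), ?_⟩, ?_⟩
  · exact prod_ofFn_eq_one fun i => comm_eq_one
      (Prod.ext (by simp [v]) (mul_comm _ _))
  · simp only [ofOrientable_of, Sum.elim_inl, u, Fin.cons_zero]
  · simp only [ofOrientable_of, Sum.elim_inl, u, Fin.cons_zero, Fin.cons_succ]
  · rintro (i | i)
    · exact ⟨PresentedGroup.of (Sum.inl i.succ.succ), by
        simp only [ofOrientable_of, Sum.elim_inl, u, Fin.cons_succ]⟩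
    · exact ⟨PresentedGroup.of (Sum.inr i), by simp only [ofOrientable_of, Sum.elim_inr, v]⟩

theorem spark_sq {n : ℕ} : (spark : CycLamp n) ^ 2 = 1 := by
  have := light_zpow (Pi.single 0 1 : ZMod n → ZMod 2) 2
  rw [spark, ← zpow_natCast]
  refine this.trans ?_
  have h : (2 : ℤ) • (Pi.single 0 1 : ZMod n → ZMod 2) = 0 := by
    ext i
    simp only [Pi.smul_apply, zsmul_eq_mul, Pi.zero_apply]
    exact mul_eq_zero_of_left (by decide) _
  rw [h]; rfl

theorem isLamplit_nonorientable (m : ℕ) : IsLamplit (NonorientableSurfaceGroup (m + 3)) := by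
  -- The squares of `step` and `step⁻¹` cancel and `spark` is an involution. The second generator
  -- also carries a coordinate of `(ℤ/2)^ι`, isolated by the product of the first two.
  let u (n : ℕ) : Fin (m + 3) → CycLamp n × (Fin (m + 1) → CycTwo) :=
    Fin.cons (step, 1) (Fin.cons (step⁻¹, Pi.mulSingle 0 flip)
      (Fin.cons (spark, 1) fun i => (1, Pi.mulSingle i.succ flip) :
        Fin (m + 1) → CycLamp n × (Fin (m + 1) → CycTwo)) :
      Fin (m + 2) → CycLamp n × (Fin (m + 1) → CycTwo))
  have hu0 (n) : u n 0 = (step, 1) := rfl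
  have hu1 (n) : u n (Fin.succ 0) = (step⁻¹, Pi.mulSingle 0 flip) := rfl
  have hu2 (n) : u n (Fin.succ (Fin.succ 0)) = (spark, 1) := rfl
  have hu3 (n) (i) : u n (Fin.succ (Fin.succ (Fin.succ i))) = (1, Pi.mulSingle i.succ flip) := rfl
  have hrel (n : ℕ) : (List.ofFn fun i => u n i ^ 2).prod = 1 := by
    rw [List.ofFn_succ, List.ofFn_succ, List.ofFn_succ, List.prod_cons, List.prod_cons,
      List.prod_cons, prod_ofFn_eq_one, hu0, hu1, hu2]
    · ext1
      · simp [spark_sq]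
      · simp [cycTwo_fun_sq]
    · intro i
      rw [hu3]
      ext1
      · simp
      · simp [cycTwo_fun_sq]
  refine isLamplit_of_generators (ι := Fin (m + 1)) PresentedGroup.of
    (PresentedGroup.closure_range_of _) (by simp)
    fun n => ⟨ofNonorientable (u n) (hrel n), ⟨PresentedGroup.of 0, ?_⟩,
      ⟨PresentedGroup.of (Fin.succ (Fin.succ 0)), ?_⟩, ?_⟩
  · rw [ofNonorientable_of, hu0]
  · rw [ofNonorientable_of, hu2]
  · intro i
    refine Fin.cases ?_ (fun i => ?_) i
    · refine ⟨PresentedGroup.of 0 * PresentedGroup.of (Fin.succ 0), ?_⟩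
      rw [map_mul, ofNonorientable_of, ofNonorientable_of, hu0, hu1]
      simp
    · exact ⟨PresentedGroup.of i.succ.succ.succ, by rw [ofNonorientable_of, hu3]⟩

/-! ### The virtually abelian factors -/

/-- The fundamental group of the Klein bottle, as a group structure on `ℤ × ℤ`. -/
@[ext]
structure Klein where
  /-- The fibre coordinate. -/
  fst : ℤ
  /-- The base coordinate. -/
  snd : ℤ

namespace Klein

instance : One Klein := ⟨⟨0, 0⟩⟩
instance : Mul Klein := ⟨fun a b => ⟨a.fst + a.snd.negOnePow * b.fst, a.snd + b.snd⟩⟩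
instance : Inv Klein := ⟨fun a => ⟨-(a.snd.negOnePow * a.fst), -a.snd⟩⟩

@[simp] theorem fst_one : (1 : Klein).fst = 0 := rfl
@[simp] theorem snd_one : (1 : Klein).snd = 0 := rfl
@[simp] theorem fst_mul (a b : Klein) : (a * b).fst = a.fst + a.snd.negOnePow * b.fst := rfl
@[simp] theorem snd_mul (a b : Klein) : (a * b).snd = a.snd + b.snd := rfl
@[simp] theorem fst_inv (a : Klein) : a⁻¹.fst = -(a.snd.negOnePow * a.fst) := rfl
@[simp] theorem snd_inv (a : Klein) : a⁻¹.snd = -a.snd := rfl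

instance : Group Klein :=
  Group.ofLeftAxioms
    (fun a b c => by
      ext
      · simp [Int.negOnePow_add]; ring
      · simp [add_assoc])
    (fun a => by ext <;> simp)
    (fun a => by ext <;> simp [Int.negOnePow_neg])

/-- The fibre generator. -/
def s : Klein := ⟨1, 0⟩

/-- The base generator. -/
def t : Klein := ⟨0, 1⟩

theorem s_zpow (n : ℤ) : s ^ n = ⟨n, 0⟩ := by
  induction n using Int.induction_on with
  | zero => rfl
  | succ n ih => rw [zpow_add_one, ih]; ext <;> simp [s]
  | pred n ih => rw [zpow_sub_one, ih]; ext <;> simp [s]; ring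

theorem t_zpow (n : ℤ) : t ^ n = ⟨0, n⟩ := by
  induction n using Int.induction_on with
  | zero => rfl
  | succ n ih => rw [zpow_add_one, ih]; ext <;> simp [t]
  | pred n ih => rw [zpow_sub_one, ih]; ext <;> simp [t]; ring

theorem eq_zpow_mul (x : Klein) : x = s ^ x.fst * t ^ x.snd := by
  rw [s_zpow, t_zpow]; ext <;> simp

theorem zpow_conj {G : Type*} [Group G] {σ τ : G} (h : τ * σ * τ⁻¹ = σ⁻¹) (i j : ℤ) :
    τ ^ j * σ ^ i = σ ^ ((j.negOnePow : ℤ) * i) * τ ^ j := by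
  have h1 : ∀ i : ℤ, τ * σ ^ i = σ ^ (-i) * τ := fun i => by
    rw [← mul_inv_eq_iff_eq_mul, ← MulAut.conj_apply, map_zpow, MulAut.conj_apply, h, inv_zpow,
      zpow_neg]
  have h2 : ∀ i : ℤ, τ⁻¹ * σ ^ i = σ ^ (-i) * τ⁻¹ := fun i => by
    rw [inv_mul_eq_iff_eq_mul, ← mul_assoc, h1, neg_neg, mul_inv_cancel_right]
  induction j using Int.induction_on generalizing i with
  | zero => simp
  | succ n ih =>
    rw [zpow_add_one, mul_assoc, h1, ← mul_assoc, ih, mul_assoc, Int.negOnePow_succ]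
    simp
  | pred n ih =>
    rw [zpow_sub_one, mul_assoc, h2, ← mul_assoc, ih, mul_assoc, Int.negOnePow_sub]
    simp

/-- The homomorphism from the Klein bottle group given by elements satisfying its relation. -/
def lift {G : Type*} [Group G] (σ τ : G) (h : τ * σ * τ⁻¹ = σ⁻¹) : Klein →* G :=
  MonoidHom.mk' (fun x => σ ^ x.fst * τ ^ x.snd) fun x y => by
    rw [fst_mul, snd_mul, zpow_add, zpow_add, mul_assoc (σ ^ x.fst) (τ ^ x.snd),
      ← mul_assoc (τ ^ x.snd), zpow_conj h]
    simp only [mul_assoc]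

theorem lift_apply {G : Type*} [Group G] (σ τ : G) (h : τ * σ * τ⁻¹ = σ⁻¹) (x : Klein) :
    lift σ τ h x = σ ^ x.fst * τ ^ x.snd := rfl

theorem hom_ext {G : Type*} [Group G] {f g : Klein →* G} (hs : f s = g s) (ht : f t = g t) :
    f = g := by
  ext x
  rw [eq_zpow_mul x, map_mul, map_mul, map_zpow, map_zpow, map_zpow, map_zpow, hs, ht]

end Klein

theorem nonorientable_two_relation :
    (PresentedGroup.of 0 : NonorientableSurfaceGroup 2) ^ 2 * PresentedGroup.of 1 ^ 2 = 1 := by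
  simpa [List.ofFn_succ] using nonorientable_relation 2

theorem nonorientable_two_relation' :
    (PresentedGroup.of 0 : NonorientableSurfaceGroup 2) * PresentedGroup.of 0 * PresentedGroup.of 1 =
      (PresentedGroup.of 1)⁻¹ := by
  rw [eq_inv_iff_mul_eq_one, ← nonorientable_two_relation]
  simp only [sq, mul_assoc]

/-- `NS₂` is the Klein bottle group. -/
def kleinEquiv : NonorientableSurfaceGroup 2 ≃* Klein :=
  MonoidHom.toMulEquiv
    -- With `t = a₁` and `s = a₁ * a₂`, the relation `a₁² * a₂² = 1` says that `t` inverts `s`.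
    (ofNonorientable ![Klein.t, Klein.t⁻¹ * Klein.s] (by
      simp [List.ofFn_succ]; ext <;> simp [sq, Klein.s, Klein.t]))
    (Klein.lift (PresentedGroup.of 0 * PresentedGroup.of 1) (PresentedGroup.of 0) (by
      rw [mul_inv_rev, ← nonorientable_two_relation']; simp only [mul_assoc]))
    (PresentedGroup.ext fun i => by
      fin_cases i
      · simp [Klein.lift_apply, Klein.t]
      · have h := congrArg (·⁻¹) nonorientable_two_relation'
        simpa [Klein.lift_apply, Klein.t, Klein.s, mul_assoc] using h)
    (Klein.hom_ext (by simp [Klein.lift_apply, Klein.s])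
      (by simp [Klein.lift_apply, Klein.t]))

theorem orientable_one_commute :
    Commute (PresentedGroup.of (Sum.inl 0) : OrientableSurfaceGroup 1)
      (PresentedGroup.of (Sum.inr 0)) := by
  have h : comm (PresentedGroup.of (Sum.inl 0) : OrientableSurfaceGroup 1)
      (PresentedGroup.of (Sum.inr 0)) = 1 := by
    simpa [List.ofFn_succ] using orientable_relation 1
  rw [comm, mul_inv_eq_one, mul_inv_eq_iff_eq_mul] at h
  exact h

/-- `S₁` is free abelian of rank two. -/
def torusEquiv : OrientableSurfaceGroup 1 ≃* CycInf × CycInf :=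
  MonoidHom.toMulEquiv
    (ofOrientable (Sum.elim (fun _ => (Multiplicative.ofAdd 1, 1)) fun _ => (1, Multiplicative.ofAdd 1))
      (prod_ofFn_eq_one fun _ => comm_eq_one (Commute.all _ _)))
    (MonoidHom.mk' (fun x => PresentedGroup.of (Sum.inl 0) ^ x.1.toAdd *
        PresentedGroup.of (Sum.inr 0) ^ x.2.toAdd) fun x y => by
      simp only [Prod.fst_mul, Prod.snd_mul, toAdd_mul, zpow_add]
      exact ((orientable_one_commute.zpow_zpow _ _).mul_mul_mul_comm _ _))
    (PresentedGroup.ext fun i => by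
      rcases i with i | i <;> fin_cases i <;> simp)
    (MonoidHom.ext fun x => by
      ext <;> simp [← ofAdd_zsmul])

theorem nonorientable_one_sq : (PresentedGroup.of 0 : NonorientableSurfaceGroup 1) ^ 2 = 1 := by
  simpa [List.ofFn_succ] using nonorientable_relation 1

/-- `NS₁` has order two. -/
def projectivePlaneEquiv : NonorientableSurfaceGroup 1 ≃* CycTwo :=
  MonoidHom.toMulEquiv
    (ofNonorientable (fun _ => flip) (by simp [List.ofFn_succ]; decide))
    (MonoidHom.mk' (fun x => if x = 1 then 1 else PresentedGroup.of 0) fun x y => by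
      rcases cycTwo_eq x with rfl | rfl <;> rcases cycTwo_eq y with rfl | rfl
      · simp
      · simp
      · simp
      · have h : flip * flip = 1 := by decide
        have h' : flip ≠ 1 := by decide
        rw [h, if_pos rfl, if_neg h', ← sq, nonorientable_one_sq])
    (PresentedGroup.ext fun i => by fin_cases i; simp)
    (MonoidHom.ext fun x => by
      rcases cycTwo_eq x with rfl | rfl
      · simp
      · have h' : flip ≠ 1 := by decide
        simp [h'])

theorem isTight_cycTwo : IsTight CycTwo :=
  ⟨Unit, inferInstance, MonoidHom.pi fun _ => MonoidHom.id _, {flip}, fun f => ⟨f (), rfl⟩,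
    eq_top_iff.2 fun x _ => by
      rcases cycTwo_eq x with rfl | rfl
      · exact one_mem _
      · exact Subgroup.subset_closure (by simp), le_rfl⟩

theorem isTight_cycInf : IsTight CycInf := by
  refine ⟨Unit, inferInstance,
    MonoidHom.pi fun _ => (Int.castAddHom (ZMod 2)).toMultiplicative, {Multiplicative.ofAdd 1},
    surjective_of_mulSingle _ fun i => ⟨Multiplicative.ofAdd 1, ?_⟩,
    eq_top_iff.2 fun x _ => ?_, le_rfl⟩
  · ext; simp
  · have : x = Multiplicative.ofAdd 1 ^ x.toAdd := by simp [← ofAdd_zsmul]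
    rw [this]
    exact zpow_mem (Subgroup.subset_closure (by simp)) _

theorem isTight_klein : IsTight Klein := by
  classical
  refine ⟨Bool, inferInstance,
    MonoidHom.mk' (fun x b => Multiplicative.ofAdd (cond b (x.fst : ZMod 2) (x.snd : ZMod 2)))
      fun x y => ?_, {Klein.s, Klein.t},
    surjective_of_mulSingle _ fun i => ⟨cond i Klein.s Klein.t, ?_⟩,
    eq_top_iff.2 fun x _ => ?_, Finset.card_le_two⟩
  · ext b
    cases b
    · simp
    · rcases Int.even_or_odd x.snd with h | h
      · simp [Int.negOnePow_even _ h]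
      · simp [Int.negOnePow_odd _ h, ← sub_eq_add_neg, CharTwo.sub_eq_add]
  · ext j
    cases i <;> cases j <;> simp [Klein.s, Klein.t]
  · rw [Klein.eq_zpow_mul x]
    exact mul_mem (zpow_mem (Subgroup.subset_closure (by simp)) _)
      (zpow_mem (Subgroup.subset_closure (by simp)) _)

end FixCompressed

namespace FixCompressed

open Lamp

/-! ### Products of Klein bottle groups with small factors -/

theorem zmod_two_cast_eq_zero {a : ℤ} : (a : ZMod 2) = 0 ↔ Even a := by
  rw [even_iff_two_dvd]; exact ZMod.intCast_zmod_eq_zero_iff_dvd a 2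

/-- The sign in the multiplication disappears mod 2. -/
theorem Klein.fst_cast_add (x y : Klein) :
    ((x * y).fst : ZMod 2) = (x.fst : ZMod 2) + (y.fst : ZMod 2) := by
  rcases Int.even_or_odd x.snd with h | h
  · simp [Int.negOnePow_even _ h]
  · simp [Int.negOnePow_odd _ h, ← sub_eq_add_neg, CharTwo.sub_eq_add]

theorem cycTwo_mem {H : Subgroup CycTwo} (h : flip ∈ H) (x : CycTwo) : x ∈ H := by
  rcases cycTwo_eq x with rfl | rfl
  · exact one_mem _
  · exact h

/-- The fixed subgroup of the shear is `ℤ³ × (ℤ/2)²`, with five independent characters mod 2. The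
overgroup also contains `t` itself, not only `t²`, and conjugation by `t` produces `s²` from the
diagonal generator, so four generators suffice. -/
theorem hasUncompressedFix_klein_cycInf :
    HasUncompressedFix ((Klein × CycInf) × (CycTwo × CycTwo)) := by
  classical
  let c : Klein × CycInf →* CycTwo × CycTwo :=
    MonoidHom.mk' (fun x => (Multiplicative.ofAdd ((x.1.fst : ZMod 2) + (x.2.toAdd : ZMod 2)),
      Multiplicative.ofAdd (x.1.snd : ZMod 2))) fun x y => by
      ext
      · simp only [Prod.fst_mul, Prod.snd_mul, Klein.fst_cast_add, toAdd_mul, Int.cast_add,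
          toAdd_ofAdd]
        ring
      · simp
  have hcc : ∀ a e, Commute (c a) e := fun a e => Commute.all _ _
  have hfix : ∀ x : (Klein × CycInf) × (CycTwo × CycTwo), x ∈ fixSubgroup (shear c hcc) ↔
      Even (x.1.1.fst + x.1.2.toAdd) ∧ Even x.1.1.snd := fun x => by
    rw [mem_fixSubgroup_shear, Prod.ext_iff, ← zmod_two_cast_eq_zero, ← zmod_two_cast_eq_zero,
      Int.cast_add]
    exact Iff.rfl
  let f : fixSubgroup (shear c hcc) → Fin 5 → ZMod 2 := fun x =>
    ![((x.1.1.1.snd / 2 : ℤ) : ZMod 2), (((x.1.1.1.fst + x.1.1.2.toAdd) / 2 : ℤ) : ZMod 2),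
      (x.1.1.2.toAdd : ZMod 2), x.1.2.1.toAdd, x.1.2.2.toAdd]
  have hf : ∀ x y, f (x * y) = f x + f y := fun x y => by
    have hx := (hfix x.1).1 x.2
    ext i
    fin_cases i
    · exact zmod_two_cast_half _ _ (zmod_two_cast_eq_zero.2 hx.2)
    · have h1 := zmod_two_cast_half _ (y.1.1.1.fst + y.1.1.2.toAdd) (zmod_two_cast_eq_zero.2 hx.1)
      simp only [f, Fin.mk_one, Matrix.cons_val_one, Matrix.cons_val_zero, Pi.add_apply]
      rw [← h1]
      simp only [Subgroup.coe_mul, Prod.fst_mul, Prod.snd_mul, Klein.fst_mul,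
        Int.negOnePow_even _ hx.2, Units.val_one, one_mul, toAdd_mul]
      congr 2; ring
    all_goals simp [f]
  have key : ∀ (x : (Klein × CycInf) × (CycTwo × CycTwo)) (hx : x ∈ fixSubgroup (shear c hcc))
      (i : Fin 5), f ⟨x, hx⟩ = Pi.single i 1 →
      ∃ g, MonoidHom.mk' (fun x i => Multiplicative.ofAdd (f x i))
        (fun x y => by rw [hf]; rfl) g = Pi.mulSingle i flip := fun x hx i h => ⟨⟨x, hx⟩, by
    ext j
    rw [MonoidHom.mk'_apply, h]
    by_cases hj : j = i
    · subst hj; simp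
    · simp [hj]⟩
  refine ⟨shear c hcc, Fin 5, inferInstance,
    MonoidHom.mk' (fun x i => Multiplicative.ofAdd (f x i)) fun x y => by rw [hf]; rfl,
    {((Klein.t, 1), 1), ((Klein.s, Multiplicative.ofAdd 1), 1), (1, (flip, 1)), (1, (1, flip))},
    surjective_of_mulSingle _ fun i => ?_, fun x hx => ?_,
    Finset.card_le_four.trans_lt (by simp)⟩
  · fin_cases i
    · exact key ((⟨0, 2⟩, 1), 1) ((hfix _).2 (by simp)) _
        (funext fun j => by fin_cases j <;> rfl)
    · exact key ((⟨2, 0⟩, 1), 1) ((hfix _).2 (by simp)) _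
        (funext fun j => by fin_cases j <;> rfl)
    · exact key ((⟨-1, 0⟩, Multiplicative.ofAdd 1), 1) ((hfix _).2 (by simp)) _
        (funext fun j => by fin_cases j <;> rfl)
    · exact key (1, (flip, 1)) ((hfix _).2 (by simp)) _
        (funext fun j => by fin_cases j <;> rfl)
    · exact key (1, (1, flip)) ((hfix _).2 (by simp)) _
        (funext fun j => by fin_cases j <;> rfl)
  · obtain ⟨⟨m, hm⟩, -⟩ := (hfix x).1 hx
    obtain ⟨⟨⟨i, j⟩, z⟩, u, v⟩ := x
    obtain ⟨z, rfl⟩ := Multiplicative.ofAdd.surjective z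
    simp only [toAdd_ofAdd] at hm
    set H := Subgroup.closure ((({((Klein.t, 1), 1), ((Klein.s, Multiplicative.ofAdd 1), 1),
      (1, (flip, 1)), (1, (1, flip))} : Finset ((Klein × CycInf) × (CycTwo × CycTwo)))) :
        Set ((Klein × CycInf) × (CycTwo × CycTwo))) with hH
    have ht : (((Klein.t, 1), 1) : (Klein × CycInf) × (CycTwo × CycTwo)) ∈ H :=
      Subgroup.subset_closure (by simp)
    have hs : (((Klein.s, Multiplicative.ofAdd 1), 1) : (Klein × CycInf) × (CycTwo × CycTwo)) ∈ H :=
      Subgroup.subset_closure (by simp)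
    have hu : ((1, (u, 1)) : (Klein × CycInf) × (CycTwo × CycTwo)) ∈ H :=
      cycTwo_mem (H := H.comap ((MonoidHom.inr (Klein × CycInf) (CycTwo × CycTwo)).comp
        (MonoidHom.inl CycTwo CycTwo))) (Subgroup.subset_closure (by simp)) u
    have hv : ((1, (1, v)) : (Klein × CycInf) × (CycTwo × CycTwo)) ∈ H :=
      cycTwo_mem (H := H.comap ((MonoidHom.inr (Klein × CycInf) (CycTwo × CycTwo)).comp
        (MonoidHom.inr CycTwo CycTwo))) (Subgroup.subset_closure (by simp)) v
    have hs2 : (((⟨2, 0⟩, 1), 1) : (Klein × CycInf) × (CycTwo × CycTwo)) ∈ H := by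
      -- Conjugation by `t` inverts `s` and leaves the `ℤ` coordinate alone; dividing by the
      -- conjugate leaves `s²`.
      have := mul_mem hs (inv_mem (mul_mem (mul_mem ht hs) (inv_mem ht)))
      convert this using 1
      exact Prod.ext (Prod.ext rfl rfl) rfl
    -- As `i + z = m + m`, the exponent of `s` comes out as `z + 2 * (m - z) = i`.
    have := mul_mem (mul_mem (mul_mem (mul_mem (zpow_mem hs z) (zpow_mem hs2 (m - z)))
      (zpow_mem ht j)) hu) hv
    convert this using 1
    have e : (⟨2, 0⟩ : Klein) = Klein.s ^ (2 : ℤ) := by rw [Klein.s_zpow]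
    rw [e]
    simp only [Prod.pow_mk, ← zpow_mul, one_zpow, Prod.mk_mul_mk, one_mul, mul_one, ← zpow_add,
      ← ofAdd_zsmul, smul_eq_mul]
    rw [Klein.eq_zpow_mul ⟨i, j⟩]
    congr 5
    simp only
    linarith

/-- The automorphism of the Klein bottle group fixing `s` and sending `t` to `t * s`. -/
def Klein.twist : Klein ≃* Klein where
  toFun x := ⟨x.fst - x.snd % 2, x.snd⟩
  invFun x := ⟨x.fst + x.snd % 2, x.snd⟩
  left_inv x := by ext <;> simp
  right_inv x := by ext <;> simp
  map_mul' x y := by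
    ext
    · rcases Int.even_or_odd x.snd with h | h
      · simp only [Klein.fst_mul, Klein.snd_mul, Int.negOnePow_even _ h, Units.val_one, one_mul]
        have := Int.even_iff.1 h
        omega
      · simp only [Klein.fst_mul, Klein.snd_mul, Int.negOnePow_odd _ h, Units.val_neg,
          Units.val_one, neg_mul, one_mul]
        have := Int.odd_iff.1 h
        omega
    · simp

theorem Klein.twist_eq_self (x : Klein) : Klein.twist x = x ↔ Even x.snd := by
  rw [Int.even_iff, Klein.ext_iff]
  change x.fst - x.snd % 2 = x.fst ∧ x.snd = x.snd ↔ _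
  omega

/-- A shear into one factor of order two imposes a single parity, here on the sum of the
`s`-exponents; the twists force both `t`-exponents to be even. The fixed subgroup is `ℤ⁴ × ℤ/2`. In
the overgroup, `(s, s)` times its conjugate by the second `t` is `(s², 1)`, which saves a generator.
-/
theorem hasUncompressedFix_klein_klein :
    HasUncompressedFix ((Klein × Klein) × CycTwo) := by
  classical
  let c : Klein × Klein →* CycTwo :=
    MonoidHom.mk' (fun x => Multiplicative.ofAdd ((x.1.fst : ZMod 2) + (x.2.fst : ZMod 2)))
      fun x y => by
      rw [← ofAdd_add, Prod.fst_mul, Prod.snd_mul, Klein.fst_cast_add, Klein.fst_cast_add]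
      congr 1; ring
  have hcc : ∀ a e, Commute (c a) e := fun a e => Commute.all _ _
  let φ : (Klein × Klein) × CycTwo ≃* (Klein × Klein) × CycTwo :=
    (shear c hcc).trans ((Klein.twist.prodCongr Klein.twist).prodCongr (MulEquiv.refl _))
  have hfix : ∀ x : (Klein × Klein) × CycTwo, x ∈ fixSubgroup φ ↔
      Even x.1.1.snd ∧ Even x.1.2.snd ∧ Even (x.1.1.fst + x.1.2.fst) := fun x => by
    rw [← Klein.twist_eq_self, ← Klein.twist_eq_self, ← zmod_two_cast_eq_zero, mem_fixSubgroup]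
    change ((Klein.twist x.1.1, Klein.twist x.1.2), x.2 * c x.1) = x ↔ _
    rw [Prod.ext_iff, Prod.ext_iff, Int.cast_add, and_assoc, mul_eq_left]
    exact Iff.rfl
  let f : fixSubgroup φ → Fin 5 → ZMod 2 := fun x =>
    ![((x.1.1.1.snd / 2 : ℤ) : ZMod 2), ((x.1.1.2.snd / 2 : ℤ) : ZMod 2),
      (((x.1.1.1.fst + x.1.1.2.fst) / 2 : ℤ) : ZMod 2), (x.1.1.2.fst : ZMod 2), x.1.2.toAdd]
  have hf : ∀ x y, f (x * y) = f x + f y := fun x y => by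
    have hx := (hfix x.1).1 x.2
    ext i
    fin_cases i
    · exact zmod_two_cast_half _ _ (zmod_two_cast_eq_zero.2 hx.1)
    · exact zmod_two_cast_half _ _ (zmod_two_cast_eq_zero.2 hx.2.1)
    · have h1 := zmod_two_cast_half _ (y.1.1.1.fst + y.1.1.2.fst) (zmod_two_cast_eq_zero.2 hx.2.2)
      change ((((x * y).1.1.1.fst + (x * y).1.1.2.fst) / 2 : ℤ) : ZMod 2) = _
      refine Eq.trans ?_ h1
      simp only [Subgroup.coe_mul, Prod.fst_mul, Prod.snd_mul, Klein.fst_mul,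
        Int.negOnePow_even _ hx.1, Int.negOnePow_even _ hx.2.1, Units.val_one, one_mul]
      congr 2; ring
    · exact Klein.fst_cast_add _ _
    · rfl
  have key : ∀ (x : (Klein × Klein) × CycTwo) (hx : x ∈ fixSubgroup φ)
      (i : Fin 5), f ⟨x, hx⟩ = Pi.single i 1 →
      ∃ g, MonoidHom.mk' (fun x i => Multiplicative.ofAdd (f x i))
        (fun x y => by rw [hf]; rfl) g = Pi.mulSingle i flip := fun x hx i h => ⟨⟨x, hx⟩, by
    ext j
    rw [MonoidHom.mk'_apply, h]
    by_cases hj : j = i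
    · subst hj; simp
    · simp [hj]⟩
  refine ⟨φ, Fin 5, inferInstance,
    MonoidHom.mk' (fun x i => Multiplicative.ofAdd (f x i)) fun x y => by rw [hf]; rfl,
    {((Klein.s, Klein.s), 1), ((Klein.t, 1), 1), ((1, Klein.t), 1), (1, flip)},
    surjective_of_mulSingle _ fun i => ?_, fun x hx => ?_,
    Finset.card_le_four.trans_lt (by simp)⟩
  · fin_cases i
    · exact key ((⟨0, 2⟩, 1), 1) ((hfix _).2 (by simp)) _
        (funext fun j => by fin_cases j <;> rfl)
    · exact key ((1, ⟨0, 2⟩), 1) ((hfix _).2 (by simp)) _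
        (funext fun j => by fin_cases j <;> rfl)
    · exact key ((⟨2, 0⟩, 1), 1) ((hfix _).2 (by simp)) _
        (funext fun j => by fin_cases j <;> rfl)
    · exact key ((⟨-1, 0⟩, ⟨1, 0⟩), 1) ((hfix _).2 (by simp)) _
        (funext fun j => by fin_cases j <;> rfl)
    · exact key (1, flip) ((hfix _).2 (by simp)) _
        (funext fun j => by fin_cases j <;> rfl)
  · obtain ⟨-, -, m, hm⟩ := (hfix x).1 hx
    obtain ⟨⟨⟨i, j⟩, ⟨k, l⟩⟩, u⟩ := x
    simp only at hm
    set H := Subgroup.closure ((({((Klein.s, Klein.s), 1), ((Klein.t, 1), 1), ((1, Klein.t), 1),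
      (1, flip)} : Finset ((Klein × Klein) × CycTwo))) : Set ((Klein × Klein) × CycTwo)) with hH
    have ht : (((Klein.t, 1), 1) : (Klein × Klein) × CycTwo) ∈ H :=
      Subgroup.subset_closure (by simp)
    have ht' : (((1, Klein.t), 1) : (Klein × Klein) × CycTwo) ∈ H :=
      Subgroup.subset_closure (by simp)
    have hs : (((Klein.s, Klein.s), 1) : (Klein × Klein) × CycTwo) ∈ H :=
      Subgroup.subset_closure (by simp)
    have hu : ((1, u) : (Klein × Klein) × CycTwo) ∈ H :=
      cycTwo_mem (H := H.comap (MonoidHom.inr (Klein × Klein) CycTwo))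
        (Subgroup.subset_closure (by simp)) u
    have hs2 : (((⟨2, 0⟩, 1), 1) : (Klein × Klein) × CycTwo) ∈ H := by
      have := mul_mem hs (mul_mem (mul_mem ht' hs) (inv_mem ht'))
      convert this using 1
      exact Prod.ext (Prod.ext rfl rfl) rfl
    have := mul_mem (mul_mem (mul_mem (mul_mem (zpow_mem hs k) (zpow_mem hs2 (m - k)))
      (zpow_mem ht j)) (zpow_mem ht' l)) hu
    convert this using 1
    have e : (⟨2, 0⟩ : Klein) = Klein.s ^ (2 : ℤ) := by rw [Klein.s_zpow]
    rw [e]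
    simp only [Prod.pow_mk, ← zpow_mul, one_zpow, Prod.mk_mul_mk, one_mul, mul_one, ← zpow_add]
    rw [Klein.eq_zpow_mul ⟨i, j⟩, Klein.eq_zpow_mul ⟨k, l⟩]
    congr 5
    simp only
    linarith

/-! ### Twisted groups -/

/-- The subgroup generated by the `⟨t⟩`-conjugates of the elements of `S`. -/
def conjClosure {A : Type*} [Group A] (t : A) (S : Finset A) : Subgroup A :=
  Subgroup.closure {y | ∃ x ∈ S, ∃ n : ℤ, y = t ^ n * x * (t ^ n)⁻¹}

theorem map_mem_conjClosure {A B : Type*} [Group A] [Group B] [DecidableEq B] (j : A →* B) {t : A}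
    {S : Finset A} {a : A} (ha : a ∈ conjClosure t S) : j a ∈ conjClosure (j t) (S.image j) := by
  have h : conjClosure t S ≤ (conjClosure (j t) (S.image j)).comap j := by
    refine (Subgroup.closure_le _).2 ?_
    rintro _ ⟨x, hx, n, rfl⟩
    exact Subgroup.subset_closure ⟨j x, Finset.mem_image_of_mem _ hx, n, by simp⟩
  exact h ha

/-- Some automorphism of `A` has a fixed subgroup which maps onto `(ℤ/2)^ι` and is contained in the
subgroup generated by the `⟨t⟩`-conjugates of fewer than `|ι|` elements. -/
def IsTwisted (A : Type*) [Group A] : Prop :=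
  ∃ (φ : A ≃* A) (ι : Type) (_ : Fintype ι) (χ : fixSubgroup φ →* (ι → CycTwo)) (t : A)
    (S : Finset A), Function.Surjective χ ∧
      fixSubgroup φ ≤ conjClosure t S ∧
      S.card < Fintype.card ι

theorem IsTwisted.of_mulEquiv {A B : Type*} [Group A] [Group B] (h : IsTwisted A) (e : A ≃* B) :
    IsTwisted B := by
  classical
  obtain ⟨φ, ι, _, χ, t, S, hχ, hS, hc⟩ := h
  let ψ : B ≃* B := (e.symm.trans φ).trans e
  have hψ : ∀ x : B, x ∈ fixSubgroup ψ → e.symm x ∈ fixSubgroup φ := fun x hx => by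
    have : e (φ (e.symm x)) = x := hx
    rw [mem_fixSubgroup]
    apply e.injective
    rw [this, e.apply_symm_apply]
  let r : fixSubgroup ψ →* fixSubgroup φ :=
    (e.symm.toMonoidHom.comp (fixSubgroup ψ).subtype).codRestrict _ fun x => hψ x x.2
  have hr : Function.Surjective r := fun y => by
    refine ⟨⟨e y, ?_⟩, ?_⟩
    · have : φ y = y := y.2
      change e (φ (e.symm (e y))) = e y
      rw [e.symm_apply_apply, this]
    · apply Subtype.ext
      exact e.symm_apply_apply _
  refine ⟨ψ, ι, inferInstance, χ.comp r, e t, S.image e, hχ.comp hr, fun x hx => ?_,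
    Finset.card_image_le.trans_lt hc⟩
  have h1 := map_mem_conjClosure e.toMonoidHom (hS (hψ x hx))
  have h2 : e.toMonoidHom (e.symm x) = x := e.apply_symm_apply x
  rwa [h2] at h1

/-- Here `u` need not be `j t`, only act like it on the image of `j`; it will be the pair of both
conjugators. -/
theorem conjClosure_le_comap {A G : Type*} [Group A] [Group G] (j : A →* G) (t : A) (S : Finset A)
    (H : Subgroup G) (u : G) (hu : u ∈ H) (hS : ∀ x ∈ S, j x ∈ H)
    (hconj : ∀ (n : ℤ) (x : A), j (t ^ n * x * (t ^ n)⁻¹) = u ^ n * j x * (u ^ n)⁻¹) :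
    conjClosure t S ≤ H.comap j := by
  rw [conjClosure, Subgroup.closure_le]
  rintro _ ⟨x, hx, n, rfl⟩
  change j _ ∈ H
  rw [hconj]
  exact mul_mem (mul_mem (zpow_mem hu _) (hS x hx)) (inv_mem (zpow_mem hu _))

/-- On each factor the pair `(t, u)` conjugates as its own component. One extra generator serves
both factors, each of which has one to spare. -/
theorem IsTwisted.hasUncompressedFix_prod {A B : Type*} [Group A] [Group B] (hA : IsTwisted A)
    (hB : IsTwisted B) : HasUncompressedFix (A × B) := by
  classical
  obtain ⟨φ, ι, _, χ, t, S, hχ, hS, hc⟩ := hA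
  obtain ⟨ψ, κ, _, ξ, u, T, hξ, hT, hc'⟩ := hB
  let θ : A × B ≃* A × B := φ.prodCongr ψ
  have h1 : ∀ x : A × B, x ∈ fixSubgroup θ → x.1 ∈ fixSubgroup φ := fun x hx =>
    congrArg Prod.fst (show θ x = x from hx)
  have h2 : ∀ x : A × B, x ∈ fixSubgroup θ → x.2 ∈ fixSubgroup ψ := fun x hx =>
    congrArg Prod.snd (show θ x = x from hx)
  let r : fixSubgroup θ →* fixSubgroup φ × fixSubgroup ψ :=
    (((MonoidHom.fst A B).comp (fixSubgroup θ).subtype).codRestrict _ fun x => h1 x x.2).prod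
      (((MonoidHom.snd A B).comp (fixSubgroup θ).subtype).codRestrict _ fun x => h2 x x.2)
  have hr : Function.Surjective r := fun y =>
    ⟨⟨(y.1, y.2), Prod.ext y.1.2 y.2.2⟩, rfl⟩
  refine ⟨θ, ι ⊕ κ, inferInstance, (sumHom χ ξ).comp r,
    insert (t, u) (S.image (MonoidHom.inl A B) ∪ T.image (MonoidHom.inr A B)),
    (sumHom_surjective hχ hξ).comp hr, fun x hx => ?_, ?_⟩
  · set H := Subgroup.closure ((insert (t, u)
      (S.image (MonoidHom.inl A B) ∪ T.image (MonoidHom.inr A B)) : Finset (A × B)) : Set (A × B))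
    have htu : (t, u) ∈ H := Subgroup.subset_closure (by simp)
    have hx1 := conjClosure_le_comap (MonoidHom.inl A B) t S H (t, u) htu
      (fun x hx => Subgroup.subset_closure (by simp [hx])) (fun n x => by simp) (hS (h1 x hx))
    have hx2 := conjClosure_le_comap (MonoidHom.inr A B) u T H (t, u) htu
      (fun x hx => Subgroup.subset_closure (by simp [hx])) (fun n x => by simp) (hT (h2 x hx))
    have : x = MonoidHom.inl A B x.1 * MonoidHom.inr A B x.2 := by simp
    rw [this]
    exact mul_mem hx1 hx2
  · have e1 := Finset.card_insert_le (t, u)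
      (S.image (MonoidHom.inl A B) ∪ T.image (MonoidHom.inr A B))
    have e2 := Finset.card_union_le (S.image (MonoidHom.inl A B)) (T.image (MonoidHom.inr A B))
    have e3 : (S.image (MonoidHom.inl A B)).card ≤ S.card := Finset.card_image_le
    have e4 : (T.image (MonoidHom.inr A B)).card ≤ T.card := Finset.card_image_le
    rw [Fintype.card_sum]
    omega

end FixCompressed

namespace FixCompressed

open Lamp

/-! ### Roots and normalizers in free groups -/

/-- Distinct generators can be sent to two non-commuting transpositions. -/
theorem of_eq_of_commute {X : Type*} {i j : X}
    (h : Commute (FreeGroup.of i) (FreeGroup.of j)) : i = j := by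
  classical
  by_contra hij
  let f : FreeGroup X →* Equiv.Perm (Fin 3) :=
    FreeGroup.lift fun k => if k = i then Equiv.swap 0 1 else Equiv.swap 1 2
  have h1 := congrArg f h.eq
  rw [map_mul, map_mul] at h1
  simp only [f, FreeGroup.lift_apply_of, if_true, if_neg (Ne.symm hij)] at h1
  exact absurd h1 (by decide)

theorem isCyclic_of_isFreeGroup {H : Type*} [Group H] [IsFreeGroup H]
    (hcomm : ∀ x y : H, Commute x y) : IsCyclic H := by
  have e := IsFreeGroup.toFreeGroup H
  have hsub : Subsingleton (IsFreeGroup.Generators H) := ⟨fun i j => of_eq_of_commute <| by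
    have := (hcomm (e.symm (FreeGroup.of i)) (e.symm (FreeGroup.of j))).map e
    simpa using this⟩
  suffices IsCyclic (FreeGroup (IsFreeGroup.Generators H)) from
    isCyclic_of_surjective e.symm e.symm.surjective
  cases isEmpty_or_nonempty (IsFreeGroup.Generators H) with
  | inl h => infer_instance
  | inr h =>
    have := (Classical.inhabited_of_nonempty h)
    have := Unique.mk' (IsFreeGroup.Generators H)
    infer_instance

/-- The subgroup generated by `x` and `y` is abelian, and free by Nielsen–Schreier, hence cyclic. -/
theorem exists_root_of_commute {X : Type*} {x y : FreeGroup X} (h : Commute x y) :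
    ∃ z, x ∈ Subgroup.zpowers z ∧ y ∈ Subgroup.zpowers z := by
  let H := Subgroup.closure ({x, y} : Set (FreeGroup X))
  have hfree : IsFreeGroup H := subgroupIsFreeOfIsFree H
  have hcomm : ∀ u ∈ ({x, y} : Set (FreeGroup X)), ∀ v ∈ ({x, y} : Set (FreeGroup X)),
      u * v = v * u := by
    rintro u (rfl | rfl) v (rfl | rfl)
    exacts [rfl, h.eq, h.eq.symm, rfl]
  have := Subgroup.isMulCommutative_closure hcomm
  have := isCyclic_of_isFreeGroup (H := H) fun u v => mul_comm' u v
  obtain ⟨z, hz⟩ := IsCyclic.exists_generator (α := H)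
  have key : ∀ u : H, (u : FreeGroup X) ∈ Subgroup.zpowers (z : FreeGroup X) := fun u => by
    obtain ⟨n, hn⟩ := hz u
    exact ⟨n, by simpa using congrArg Subtype.val hn⟩
  exact ⟨z, key ⟨x, Subgroup.subset_closure (by simp)⟩, key ⟨y, Subgroup.subset_closure (by simp)⟩⟩

/-- `w` has infinite order, and any `b` with `w * b * w⁻¹ ∈ b * ⟨w⟩` lies in `⟨w⟩`. -/
structure IsRigid {B : Type*} [Group B] (w : B) : Prop where
  /-- `w` has infinite order -/
  zpow_eq_one : ∀ n : ℤ, w ^ n = 1 → n = 0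
  /-- elements moved by conjugation within their `⟨w⟩`-coset are powers of `w` -/
  mem_zpowers : ∀ (b : B) (i : ℤ), w * b * w⁻¹ = b * w ^ i → b ∈ Subgroup.zpowers w

/-- The coset condition reads `b⁻¹ * w * b = w ^ (i + 1)`. By `h2` the exponent is `1`, so `b` and
`w` commute and have a common root, which by `h1` is `w` or `w⁻¹`. -/
theorem isRigid_of_not_power {X : Type*} {w : FreeGroup X}
    (h1 : ∀ z : FreeGroup X, ∀ n : ℤ, z ^ n = w → n = 1 ∨ n = -1)
    (h2 : ∀ b : FreeGroup X, ∀ j : ℤ, b⁻¹ * w * b = w ^ j → j = 1) : IsRigid w := by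
  refine ⟨fun n hn => ?_, fun b i hi => ?_⟩
  · have := h2 1 (n + 1) (by rw [zpow_add_one, hn]; simp)
    omega
  · have h3 : b⁻¹ * w * b = w ^ (i + 1) := by
      rw [zpow_add_one, mul_assoc, inv_mul_eq_iff_eq_mul, ← mul_assoc, ← hi]
      simp
    rw [h2 b _ h3, zpow_one, mul_assoc, inv_mul_eq_iff_eq_mul] at h3
    obtain ⟨z, ⟨n, hn⟩, hb⟩ := exists_root_of_commute (show Commute w b from h3)
    have hzw : Subgroup.zpowers z ≤ Subgroup.zpowers w := by
      rw [Subgroup.zpowers_le]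
      rcases h1 z n hn with rfl | rfl
      · exact ⟨1, by simpa using hn.symm⟩
      · exact ⟨-1, by simp [← hn]⟩
    exact hzw hb

/-! ### Rigidity of the relators via the Heisenberg group -/

/-- The integral Heisenberg group. -/
@[ext]
structure Heis where
  /-- first coordinate -/
  x : ℤ
  /-- second coordinate -/
  y : ℤ
  /-- central coordinate -/
  z : ℤ

namespace Heis

instance : One Heis := ⟨⟨0, 0, 0⟩⟩
instance : Mul Heis := ⟨fun a b => ⟨a.x + b.x, a.y + b.y, a.z + b.z + a.x * b.y⟩⟩
instance : Inv Heis := ⟨fun a => ⟨-a.x, -a.y, -a.z + a.x * a.y⟩⟩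

@[simp] theorem x_one : (1 : Heis).x = 0 := rfl
@[simp] theorem y_one : (1 : Heis).y = 0 := rfl
@[simp] theorem z_one : (1 : Heis).z = 0 := rfl
@[simp] theorem x_mul (a b : Heis) : (a * b).x = a.x + b.x := rfl
@[simp] theorem y_mul (a b : Heis) : (a * b).y = a.y + b.y := rfl
@[simp] theorem z_mul (a b : Heis) : (a * b).z = a.z + b.z + a.x * b.y := rfl
@[simp] theorem x_inv (a : Heis) : a⁻¹.x = -a.x := rfl
@[simp] theorem y_inv (a : Heis) : a⁻¹.y = -a.y := rfl
@[simp] theorem z_inv (a : Heis) : a⁻¹.z = -a.z + a.x * a.y := rfl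

instance : Group Heis :=
  Group.ofLeftAxioms (fun a b c => by ext <;> simp <;> ring) (fun a => by ext <;> simp)
    (fun a => by ext <;> simp)

/-- `2z - xy` is twice the central coordinate of the logarithm, so it is linear along powers. -/
theorem zpow_coords (a : Heis) (n : ℤ) : (a ^ n).x = n * a.x ∧ (a ^ n).y = n * a.y ∧
    2 * (a ^ n).z - (a ^ n).x * (a ^ n).y = n * (2 * a.z - a.x * a.y) := by
  induction n using Int.induction_on with
  | zero => simp
  | succ n ih =>
    obtain ⟨h1, h2, h3⟩ := ih
    rw [zpow_add_one]
    simp only [x_mul, y_mul, z_mul]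
    rw [h1, h2] at h3 ⊢
    refine ⟨by ring, by ring, by linear_combination h3⟩
  | pred n ih =>
    obtain ⟨h1, h2, h3⟩ := ih
    rw [zpow_sub_one]
    simp only [x_mul, y_mul, z_mul, x_inv, y_inv, z_inv]
    rw [h1, h2] at h3 ⊢
    refine ⟨by ring, by ring, by linear_combination h3⟩

end Heis

/-- An `n`-th root of `w` has vanishing first coordinate, and then `n` times its central coordinate
is `1`. Conjugation fixes the central image, which forces `j = 1`. -/
theorem isRigid_of_heis_central {X : Type*} {w : FreeGroup X} (f : FreeGroup X →* Heis)
    (hf : f w = ⟨0, 0, 1⟩) : IsRigid w := by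
  refine isRigid_of_not_power (fun z n hn => ?_) fun b j hj => ?_
  · obtain ⟨h1, h2, h3⟩ := Heis.zpow_coords (f z) n
    rw [← map_zpow, hn, hf] at h1 h2 h3
    have hn0 : n ≠ 0 := by rintro rfl; simp at h3
    have hx : (f z).x = 0 := (mul_eq_zero.1 h1.symm).resolve_left hn0
    rw [hx] at h3
    simp only at h3
    exact Int.eq_one_or_neg_one_of_mul_eq_one (u := n) (v := (f z).z) (by linarith)
  · have h1 := congrArg f hj
    rw [map_zpow, map_mul, map_mul, map_inv] at h1
    obtain ⟨-, -, h3⟩ := Heis.zpow_coords (f w) j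
    rw [← h1, hf] at h3
    simp at h3
    linarith

/-- The first coordinate leaves only `n = ±1, ±2`. For `n = 2` the root has `x = y = 1`, and
linearity of `2z - xy` gives `2 * (2z - 1) = 4`, impossible by parity; `n = -2` is similar. -/
theorem isRigid_of_heis_square {X : Type*} {w : FreeGroup X} (f : FreeGroup X →* Heis)
    (hf : f w = ⟨2, 2, 4⟩) : IsRigid w := by
  refine isRigid_of_not_power (fun z n hn => ?_) fun b j hj => ?_
  · obtain ⟨h1, h2, h3⟩ := Heis.zpow_coords (f z) n
    rw [← map_zpow, hn, hf] at h1 h2 h3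
    simp only at h1 h2 h3
    have hdvd : n ∣ 2 := ⟨_, h1⟩
    have hle : n ≤ 2 := Int.le_of_dvd (by norm_num) hdvd
    have hge : -2 ≤ n := by
      have := Int.le_of_dvd (by norm_num) (neg_dvd.2 hdvd)
      omega
    interval_cases n
    · have hx : (f z).x = -1 := by omega
      have hy : (f z).y = -1 := by omega
      rw [hx, hy] at h3; omega
    · exact Or.inr rfl
    · omega
    · exact Or.inl rfl
    · have hx : (f z).x = 1 := by omega
      have hy : (f z).y = 1 := by omega
      rw [hx, hy] at h3; omega
  · have h1 := congrArg f hj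
    rw [map_zpow, map_mul, map_mul, map_inv] at h1
    obtain ⟨h2, -, -⟩ := Heis.zpow_coords (f w) j
    rw [← h1, hf] at h2
    simp at h2
    linarith

theorem isRigid_orientableRelator (m : ℕ) : IsRigid (orientableRelator (m + 1)) := by
  refine isRigid_of_heis_central (FreeGroup.lift (Sum.elim
    (Fin.cons ⟨1, 0, 0⟩ fun _ => 1 : Fin (m + 1) → Heis)
    (Fin.cons ⟨0, 1, 0⟩ fun _ => 1 : Fin (m + 1) → Heis))) ?_
  rw [lift_orientableRelator, List.ofFn_succ, List.prod_cons, prod_ofFn_eq_one fun i => by simp [comm]]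
  ext <;> simp

theorem isRigid_nonorientableRelator (m : ℕ) : IsRigid (nonorientableRelator (m + 2)) := by
  refine isRigid_of_heis_square (FreeGroup.lift
    (Fin.cons ⟨1, 0, 0⟩ (Fin.cons ⟨0, 1, 0⟩ fun _ => 1 : Fin (m + 1) → Heis) :
      Fin (m + 2) → Heis)) ?_
  rw [lift_nonorientableRelator, List.ofFn_succ, List.ofFn_succ, List.prod_cons, List.prod_cons,
    prod_ofFn_eq_one fun i => by simp]
  ext <;> simp [sq]

end FixCompressed

namespace FixCompressed

open Monoid Monoid.PushoutI

/-! ### Fixed points of automorphisms of amalgams -/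

section Amalgam

variable {ι : Type*} {G : ι → Type*} [∀ i, Group (G i)] {H : Type*} [Group H]
  {φ : ∀ i, H →* G i}

/-- The product in the amalgam of a list of letters. -/
def listProd (φ : ∀ i, H →* G i) (l : List (Σ i, G i)) : PushoutI φ :=
  (l.map fun x => of x.1 x.2).prod

@[simp] theorem listProd_nil : listProd φ [] = 1 := rfl

@[simp] theorem listProd_cons (x : Σ i, G i) (l : List (Σ i, G i)) :
    listProd φ (x :: l) = of x.1 x.2 * listProd φ l := rfl

theorem listProd_append (l l' : List (Σ i, G i)) :
    listProd φ (l ++ l') = listProd φ l * listProd φ l' := by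
  simp [listProd]

/-- A list of letters outside the amalgamated subgroup, with adjacent letters from different
factors. -/
structure IsReducedList (φ : ∀ i, H →* G i) (l : List (Σ i, G i)) : Prop where
  /-- adjacent letters come from different factors -/
  chain : l.IsChain fun x y => x.1 ≠ y.1
  /-- letters are outside the amalgamated subgroup -/
  notMem : ∀ x ∈ l, x.2 ∉ (φ x.1).range

theorem ofCoprodI_prod (w : CoprodI.Word G) :
    (ofCoprodI w.prod : PushoutI φ) = listProd φ w.toList := by
  rw [CoprodI.Word.prod, map_list_prod, List.map_map]
  rfl

theorem IsReducedList.eq_nil (hφ : ∀ i, Function.Injective (φ i)) {l : List (Σ i, G i)}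
    (h : IsReducedList φ l) (hl : listProd φ l = 1) : l = [] := by
  let w : CoprodI.Word G := ⟨l, fun x hx h1 => h.notMem x hx (by rw [h1]; exact one_mem _), h.chain⟩
  have hw : Reduced φ w := fun x hx => h.notMem x hx
  have := hw.eq_empty_of_mem_range hφ (by
    rw [ofCoprodI_prod]
    change listProd φ l ∈ _
    rw [hl]
    exact one_mem _)
  exact congrArg CoprodI.Word.toList this

theorem exists_isReducedList (hφ : ∀ i, Function.Injective (φ i)) (g : PushoutI φ) :
    ∃ h l, IsReducedList φ l ∧ g = base φ h * listProd φ l := by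
  classical
  obtain ⟨d⟩ := NormalWord.transversal_nonempty φ hφ
  let w : NormalWord d := NormalWord.equiv g
  have hg : w.prod = g := NormalWord.equiv.symm_apply_apply g
  refine ⟨w.head, w.toList, ⟨w.chain_ne, fun x hx hx' => ?_⟩, ?_⟩
  · have h1 := w.normalized x.1 x.2 hx
    -- A letter in both the amalgamated subgroup and the transversal factors as `x * 1` and as `1 *
    -- x`; uniqueness makes it trivial.
    have h2 := (d.compl x.1).1 (a₁ := (⟨x.2, hx'⟩, ⟨1, d.one_mem x.1⟩))
      (a₂ := (⟨1, one_mem _⟩, ⟨x.2, h1⟩)) (by simp)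
    have h3 : x.2 = 1 := congrArg (fun p => (p.1 : G x.1)) h2
    exact w.ne_one x hx h3
  · rw [← hg, NormalWord.prod, ofCoprodI_prod]

theorem listProd_inv_reverse (l : List (Σ i, G i)) :
    listProd φ (l.map fun x => ⟨x.1, x.2⁻¹⟩).reverse = (listProd φ l)⁻¹ := by
  induction l with
  | nil => simp
  | cons x l ih =>
    rw [List.map_cons, List.reverse_cons, listProd_append, ih]
    simp

/-- Otherwise the inverse of `l`, then the letter `x⁻¹ * y`, then `l'` would be a nonempty reduced
list with product `1`. -/
theorem head_inv_mul_mem (hφ : ∀ i, Function.Injective (φ i)) {i : ι} {x y : G i}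
    {l l' : List (Σ i, G i)} (h : IsReducedList φ (⟨i, x⟩ :: l))
    (h' : IsReducedList φ (⟨i, y⟩ :: l'))
    (heq : listProd φ (⟨i, x⟩ :: l) = listProd φ (⟨i, y⟩ :: l')) :
    x⁻¹ * y ∈ (φ i).range := by
  by_contra hxy
  have hred : IsReducedList φ ((l.map fun x => ⟨x.1, x.2⁻¹⟩).reverse ++ ⟨i, x⁻¹ * y⟩ :: l') := by
    have hc := List.isChain_cons.1 h.chain
    have hc' := List.isChain_cons.1 h'.chain
    refine ⟨?_, ?_⟩
    · rw [List.isChain_append]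
      refine ⟨?_, ?_, ?_⟩
      · rw [List.isChain_reverse, List.isChain_map]
        exact hc.2.imp fun _ _ => Ne.symm
      · rw [List.isChain_cons]
        exact hc'
      · intro a ha b hb
        simp only [List.head?_cons, Option.mem_def, Option.some.injEq] at hb
        subst hb
        rw [List.getLast?_reverse, List.head?_map] at ha
        obtain ⟨c, hc1, rfl⟩ := Option.map_eq_some_iff.1 ha
        exact (hc.1 c hc1).symm
    · intro z hz
      rw [List.mem_append, List.mem_reverse, List.mem_map, List.mem_cons] at hz
      rcases hz with ⟨a, ha, rfl⟩ | rfl | hz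
      · rw [inv_mem_iff]
        exact h.notMem a (List.mem_cons_of_mem _ ha)
      · exact hxy
      · exact h'.notMem z (List.mem_cons_of_mem _ hz)
  have := hred.eq_nil hφ (by
    rw [listProd_append, listProd_inv_reverse, listProd_cons, inv_mul_eq_one]
    rw [listProd_cons, listProd_cons] at heq
    simp only [map_mul, map_inv, mul_assoc]
    rw [← heq, inv_mul_cancel_left])
  simp at this

/-- An endomorphism of an amalgam induced by endomorphisms of the factors has all its fixed points
in the factor `G i₀`, if no other factor has elements outside the amalgamated subgroup `H` that stay
in their `H`-coset, and `G i₀` has only fixed ones. -/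
theorem mem_range_of_fixed (hφ : ∀ i, Function.Injective (φ i)) (ψ : ∀ i, G i →* G i)
    (hψ : ∀ i, Function.Injective (ψ i)) (hψφ : ∀ i h, ψ i (φ i h) = φ i h) (i₀ : ι)
    (h₀ : ∀ a c, ψ i₀ a = a * φ i₀ c → c = 1)
    (h₁ : ∀ i, i ≠ i₀ → ∀ b c, ψ i b = b * φ i c → b ∈ (φ i).range)
    (Φ : PushoutI φ →* PushoutI φ) (hΦ : ∀ i x, Φ (of i x) = of i (ψ i x))
    (g : PushoutI φ) (hg : Φ g = g) : g ∈ (of (φ := φ) i₀).range := by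
  have hmap : ∀ l, Φ (listProd φ l) = listProd φ (l.map fun x => ⟨x.1, ψ x.1 x.2⟩) := fun l => by
    induction l with
    | nil => simp
    | cons x l ih => simp [hΦ, ih]
  have hred : ∀ l, IsReducedList φ l →
      IsReducedList φ (l.map fun x => (⟨x.1, ψ x.1 x.2⟩ : Σ i, G i)) := fun l hl => by
    refine ⟨(List.isChain_map _).2 hl.chain, fun x hx => ?_⟩
    obtain ⟨y, hy, rfl⟩ := List.mem_map.1 hx
    rintro ⟨c, hc⟩
    refine hl.notMem y hy ⟨c, hψ y.1 ?_⟩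
    rw [hψφ]
    exact hc
  -- A reduced list and its image have the same product, so their first letters lie in the same
  -- coset of the amalgamated subgroup; `h₁` and `h₀` then apply.
  have hhead : ∀ i x l, IsReducedList φ (⟨i, x⟩ :: l) →
      Φ (listProd φ (⟨i, x⟩ :: l)) = listProd φ (⟨i, x⟩ :: l) →
      i = i₀ ∧ ψ i x = x := fun i x l hl hfix => by
    rw [hmap] at hfix
    obtain ⟨c, hc⟩ := head_inv_mul_mem hφ hl (hred _ hl) hfix.symm
    have hc' : ψ i x = x * φ i c := by rw [hc, mul_inv_cancel_left]
    have hi : i = i₀ := by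
      by_contra hi
      exact hl.notMem _ List.mem_cons_self (h₁ i hi x c hc')
    subst hi
    refine ⟨rfl, ?_⟩
    rw [hc', h₀ x c hc', map_one, mul_one]
  obtain ⟨h, l, hl, rfl⟩ := exists_isReducedList hφ g
  match l, hl with
  | [], _ => exact ⟨φ i₀ h, by rw [of_apply_eq_base, listProd_nil, mul_one]⟩
  | ⟨i, x⟩ :: l, hl =>
    -- The prefix from `H` is absorbed into the first letter.
    have hl' : IsReducedList φ (⟨i, φ i h * x⟩ :: l) := by
      refine ⟨?_, fun z hz => ?_⟩
      · have := hl.chain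
        rw [List.isChain_cons] at this ⊢
        exact this
      · rcases List.mem_cons.1 hz with rfl | hz
        · change φ i h * x ∉ (φ i).range
          rw [Subgroup.mul_mem_cancel_left _ (MonoidHom.mem_range.2 ⟨h, rfl⟩)]
          exact hl.notMem _ List.mem_cons_self
        · exact hl.notMem z (List.mem_cons_of_mem _ hz)
    have e : base φ h * listProd φ (⟨i, x⟩ :: l) = listProd φ (⟨i, φ i h * x⟩ :: l) := by
      simp [← of_apply_eq_base φ i, mul_assoc]
    rw [e] at hg ⊢
    obtain ⟨rfl, hx⟩ := hhead _ _ _ hl' hg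
    match l, hl' with
    | [], _ => exact ⟨φ i h * x, by simp⟩
    | ⟨j, y⟩ :: l, hl' =>
      -- Cancelling the fixed first letter leaves a fixed reduced tail. Its first letter would also
      -- lie in `G i₀`, against alternation.
      rw [listProd_cons, map_mul, hΦ, hx, mul_right_inj] at hg
      obtain ⟨rfl, -⟩ := hhead j y l ⟨(List.isChain_cons.1 hl'.chain).2,
        fun z hz => hl'.notMem z (List.mem_cons_of_mem _ hz)⟩ hg
      exact absurd rfl ((List.isChain_cons.1 hl'.chain).1 ⟨j, y⟩ rfl)

end Amalgam

end FixCompressed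

namespace FixCompressed

open Lamp

/-! ### Twists of free groups -/

theorem conj_mem_conjClosure {A : Type*} [Group A] {t : A} {S : Finset A} {y : A}
    (hy : y ∈ conjClosure t S) (k : ℤ) : t ^ k * y * (t ^ k)⁻¹ ∈ conjClosure t S := by
  have h : conjClosure t S ≤ (conjClosure t S).comap (MulAut.conj (t ^ k)).toMonoidHom := by
    refine (Subgroup.closure_le _).2 ?_
    rintro _ ⟨x, hx, n, rfl⟩
    refine Subgroup.subset_closure ⟨x, hx, k + n, ?_⟩
    change t ^ k * (t ^ n * x * (t ^ n)⁻¹) * (t ^ k)⁻¹ = _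
    rw [zpow_add, mul_inv_rev]
    simp only [mul_assoc]
  exact h hy

/-- Collecting all powers of `t` on the right turns the other letters into `⟨t⟩`-conjugates of
themselves. -/
theorem mul_zpow_inv_mem_conjClosure {X : Type*} (t : X) (e : FreeGroup X →* Multiplicative ℤ)
    (het : e (FreeGroup.of t) = Multiplicative.ofAdd 1)
    (he : ∀ x, x ≠ t → e (FreeGroup.of x) = 1) (S : Finset (FreeGroup X))
    (hS : ∀ x, x ≠ t → FreeGroup.of x ∈ S) (a : FreeGroup X) :
    a * (FreeGroup.of t ^ (e a).toAdd)⁻¹ ∈ conjClosure (FreeGroup.of t) S := by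
  have hgen : ∀ x, x ≠ t → FreeGroup.of x ∈ conjClosure (FreeGroup.of t) S := fun x hx =>
    Subgroup.subset_closure ⟨_, hS x hx, 0, by simp⟩
  induction a using FreeGroup.induction_on with
  | C1 => simp
  | of x =>
    by_cases hx : x = t
    · subst hx; simp [het]
    · simpa [he x hx] using hgen x hx
  | inv_of x _ =>
    by_cases hx : x = t
    · subst hx; simp [het]
    · simpa [he x hx] using hgen x hx
  | mul a b ha hb =>
    have := mul_mem ha (conj_mem_conjClosure hb (e a).toAdd)
    convert this using 1
    rw [map_mul, toAdd_mul, add_comm, zpow_add]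
    group

section Twist

variable {X : Type*} [DecidableEq X]

/-- The automorphism sending `t` to `t * s` and fixing all other generators. -/
def freeTwist (t s : X) (h : s ≠ t) : FreeGroup X ≃* FreeGroup X :=
  MonoidHom.toMulEquiv
    (FreeGroup.lift fun x => if x = t then FreeGroup.of t * FreeGroup.of s else FreeGroup.of x)
    (FreeGroup.lift fun x => if x = t then FreeGroup.of t * (FreeGroup.of s)⁻¹ else FreeGroup.of x)
    (by
      ext x
      by_cases hx : x = t
      · subst hx; simp [h]
      · simp [hx])
    (by
      ext x
      by_cases hx : x = t
      · subst hx; simp [h]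
      · simp [hx])

@[simp] theorem freeTwist_of_self (t s : X) (h : s ≠ t) :
    freeTwist t s h (FreeGroup.of t) = FreeGroup.of t * FreeGroup.of s := by
  simp [freeTwist]

theorem freeTwist_of_ne (t s : X) (h : s ≠ t) {x : X} (hx : x ≠ t) :
    freeTwist t s h (FreeGroup.of x) = FreeGroup.of x := by
  simp [freeTwist, hx]

/-- The homomorphism to the lamplighter group under which `t` moves and `s` lights the lamp. -/
def lampHom (t s : X) : FreeGroup X →* Lamp ℤ ℤ :=
  FreeGroup.lift fun x => if x = t then step else if x = s then light (Pi.single 0 1) else 1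

@[simp] theorem lampHom_self (t s : X) : lampHom t s (FreeGroup.of t) = step := by
  simp [lampHom]

@[simp] theorem lampHom_lit {t s : X} (h : s ≠ t) :
    lampHom t s (FreeGroup.of s) = light (Pi.single 0 1) := by
  simp [lampHom, h]

theorem pos_lampHom_of_ne {t s : X} {x : X} (h : x ≠ t) :
    (lampHom t s (FreeGroup.of x)).pos = 0 := by
  simp only [lampHom, FreeGroup.lift_apply_of, if_neg h]
  split_ifs <;> rfl

/-- All lamps at positive positions lit. -/
def halfLine : Lamp ℤ ℤ := light fun i => if 1 ≤ i then 1 else 0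

/-- In the unrestricted wreath product the twist becomes inner: a half line and its translate by one
step differ in exactly the lamp that `s` lights in `t * s`. -/
theorem lampHom_freeTwist (t s : X) (h : s ≠ t) (a : FreeGroup X) :
    lampHom t s (freeTwist t s h a) = halfLine * lampHom t s a * halfLine⁻¹ := by
  have : (lampHom t s).comp (freeTwist t s h).toMonoidHom =
      (MulAut.conj halfLine).toMonoidHom.comp (lampHom t s) := by
    ext1 x
    by_cases hx : x = t
    · subst hx
      simp only [MonoidHom.comp_apply, MulEquiv.coe_toMonoidHom, freeTwist_of_self, map_mul,
        lampHom_self, lampHom_lit h, MulAut.conj_apply]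
      ext i
      · simp only [halfLine, lamps_mul, lamps_step, lamps_light, lamps_inv, pos_mul, pos_step,
          pos_light, Pi.zero_apply, Pi.single_apply, Int.cast_id]
        split_ifs <;> omega
      · simp [halfLine]
    · simp only [MonoidHom.comp_apply, MulEquiv.coe_toMonoidHom, freeTwist_of_ne t s h hx,
        MulAut.conj_apply]
      by_cases hs : x = s
      · subst hs
        rw [lampHom_lit h]
        ext i <;> simp [halfLine]
      · have : lampHom t s (FreeGroup.of x) = 1 := by simp [lampHom, hx, hs]
        rw [this]; simp
  exact DFunLike.congr_fun this a

/-- The lamps of `a` cancel, leaving the half line minus its translate by the position of `a`. -/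
theorem freeTwist_eq_mul (t s : X) (h : s ≠ t) {a c : FreeGroup X}
    (hac : freeTwist t s h a = a * c) {f : ℤ → ℤ} (hc : lampHom t s c = light f) (i : ℤ) :
    (if 1 ≤ i then 1 else 0 : ℤ) - (if 1 ≤ i - (lampHom t s a).pos then 1 else 0) =
      f (i - (lampHom t s a).pos) := by
  have h1 := congrArg (fun b => (lampHom t s b).lamps i) hac
  simp only [lampHom_freeTwist, map_mul, hc] at h1
  simp [halfLine] at h1
  linarith

theorem pos_eq_zero_of_freeTwist (t s : X) (h : s ≠ t) {a : FreeGroup X}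
    (ha : freeTwist t s h a = a) : (lampHom t s a).pos = 0 := by
  have h1 := freeTwist_eq_mul t s h (c := 1) (f := 0) (by rw [mul_one, ha]) (by rw [map_one]; rfl)
  have h2 := h1 (lampHom t s a).pos
  have h3 := h1 ((lampHom t s a).pos + 1)
  simp at h2 h3
  split_ifs at h2 h3 <;> omega

/-- Let `p` be the position of `a`. Reading lamps `p` and `p + 1` gives `n * ε = 1`, `n = 0` if `p >
0`, and `n * ε = 0`, `n = -1` if `p < 0`; both are absurd, and `p = 0` gives `n = 0`. -/
theorem eq_zero_of_freeTwist (t s : X) (h : s ≠ t) {ε : ℤ} (hε : ε ≠ 0) {a : FreeGroup X} {n : ℤ}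
    (ha : freeTwist t s h a = a * (FreeGroup.of t * FreeGroup.of s * (FreeGroup.of t)⁻¹ *
      FreeGroup.of s ^ ε) ^ n) : n = 0 := by
  have hd : lampHom t s ((FreeGroup.of t * FreeGroup.of s * (FreeGroup.of t)⁻¹ *
      FreeGroup.of s ^ ε) ^ n) = light (n • (Pi.single 1 1 + ε • Pi.single 0 1)) := by
    rw [map_zpow, ← light_zpow]
    congr 1
    simp only [map_mul, map_inv, map_zpow, lampHom_self, lampHom_lit h, light_zpow]
    ext i
    · simp [Pi.single_apply, sub_eq_zero]
    · simp
  have h1 := freeTwist_eq_mul t s h ha hd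
  have h2 := h1 (lampHom t s a).pos
  have h3 := h1 ((lampHom t s a).pos + 1)
  simp at h2 h3
  split_ifs at h2 h3
  all_goals try omega
  have : n = -1 := by omega
  subst this
  omega

theorem mem_conjClosure_of_freeTwist (t s : X) (h : s ≠ t) {a : FreeGroup X}
    (ha : freeTwist t s h a = a) (S : Finset (FreeGroup X))
    (hS : ∀ x, x ≠ t → FreeGroup.of x ∈ S) : a ∈ conjClosure (FreeGroup.of t) S := by
  have h1 := mul_zpow_inv_mem_conjClosure t (posHom.comp (lampHom t s))
    (by rw [MonoidHom.comp_apply, lampHom_self]; rfl)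
    (fun x hx => congrArg Multiplicative.ofAdd (pos_lampHom_of_ne hx)) S hS a
  have h2 : ((posHom.comp (lampHom t s)) a).toAdd = 0 := pos_eq_zero_of_freeTwist t s h ha
  rw [h2] at h1
  simpa using h1

theorem freeTwist_conj (t s : X) (h : s ≠ t) :
    freeTwist t s h (FreeGroup.of t * FreeGroup.of s * (FreeGroup.of t)⁻¹) =
      FreeGroup.of t * FreeGroup.of s * (FreeGroup.of t)⁻¹ := by
  rw [map_mul, map_mul, map_inv, freeTwist_of_self, freeTwist_of_ne t s h h]
  group

end Twist

/-- The lamps at the even and the odd position, on a subgroup of elements at position `0`. -/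
theorem exists_lamp_character {A ι : Type*} [Group A] (K : Subgroup A)
    (f : A →* CycLamp 2 × (ι → CycTwo)) (hf : ∀ a ∈ K, (f a).1.pos = 0) :
    ∃ χ : K →* (ZMod 2 ⊕ ι → CycTwo), ∀ a : K,
      χ a = Sum.elim (fun i => Multiplicative.ofAdd ((f a).1.lamps i)) (f a).2 :=
  ⟨MonoidHom.mk' (fun a => Sum.elim (fun i => Multiplicative.ofAdd ((f a).1.lamps i)) (f a).2)
    fun a b => by
      ext i
      rcases i with i | i
      · simp [hf a a.2]
      · simp, fun _ => rfl⟩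

theorem surjective_of_lamp_character {A ι : Type*} [Group A] [Finite ι] [DecidableEq ι]
    {K : Subgroup A}
    {f : A →* CycLamp 2 × (ι → CycTwo)} {χ : K →* (ZMod 2 ⊕ ι → CycTwo)}
    (hχ : ∀ a : K, χ a = Sum.elim (fun i => Multiplicative.ofAdd ((f a).1.lamps i)) (f a).2)
    (h₁ : ∀ i : ZMod 2, ∃ x ∈ K, f x = (light (Pi.single i 1), 1))
    (h₂ : ∀ i, ∃ x ∈ K, f x = (1, Pi.mulSingle i flip)) : Function.Surjective χ := by
  refine surjective_of_mulSingle _ fun i => ?_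
  rcases i with i | i
  · obtain ⟨x, hx, hfx⟩ := h₁ i
    refine ⟨⟨x, hx⟩, ?_⟩
    rw [hχ]
    ext j
    rcases j with j | j
    · by_cases hj : j = i
      · subst hj; simp [hfx]
      · simp [hj, hfx]
    · simp [hfx]
  · obtain ⟨x, hx, hfx⟩ := h₂ i
    refine ⟨⟨x, hx⟩, ?_⟩
    rw [hχ]
    ext j
    rcases j with j | j <;> simp [hfx, Pi.mulSingle_apply]

theorem isTwisted_freeGroup (m : ℕ) : IsTwisted (FreeGroup (Fin (m + 2))) := by
  classical
  let f : FreeGroup (Fin (m + 2)) →* CycLamp 2 × (Fin m → CycTwo) :=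
    FreeGroup.lift (Fin.cons (step, 1) (Fin.cons (spark, 1)
      fun i => (1, Pi.mulSingle i flip) : Fin (m + 1) → CycLamp 2 × (Fin m → CycTwo)) :
        Fin (m + 2) → CycLamp 2 × (Fin m → CycTwo))
  have hf0 : f (FreeGroup.of 0) = (step, 1) := by
    simp only [f, FreeGroup.lift_apply_of, Fin.cons_zero]
  have hf1 : f (FreeGroup.of (Fin.succ 0)) = (spark, 1) := by
    simp only [f, FreeGroup.lift_apply_of, Fin.cons_zero, Fin.cons_succ]
  have hf2 (i) : f (FreeGroup.of (Fin.succ (Fin.succ i))) = (1, Pi.mulSingle i flip) := by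
    simp only [f, FreeGroup.lift_apply_of, Fin.cons_succ]
  have hne : (Fin.succ 0 : Fin (m + 2)) ≠ 0 := Fin.succ_ne_zero _
  have hpos : ∀ a, (f a).1.pos = (lampHom (0 : Fin (m + 2)) (Fin.succ 0) a).pos := fun a => by
    have : (posHom.comp (MonoidHom.fst _ _)).comp f =
        posHom.comp (lampHom (0 : Fin (m + 2)) (Fin.succ 0)) := by
      ext i
      simp only [MonoidHom.comp_apply]
      refine congrArg Multiplicative.toAdd (congrArg Multiplicative.ofAdd ?_)
      refine Fin.cases ?_ (fun i => ?_) i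
      · rw [lampHom_self, hf0]; rfl
      · rw [pos_lampHom_of_ne (Fin.succ_ne_zero _)]
        refine Fin.cases ?_ (fun i => ?_) i
        · rw [hf1]; rfl
        · rw [hf2]; rfl
    exact congrArg Multiplicative.toAdd (DFunLike.congr_fun this a)
  obtain ⟨χ, hχ⟩ := exists_lamp_character (fixSubgroup (freeTwist 0 (Fin.succ 0) hne)) f
    fun a ha => by rw [hpos]; exact pos_eq_zero_of_freeTwist _ _ hne ha
  -- The fixed elements `s` and `t * s * t⁻¹` light the two lamps, and the other `m` generators give
  -- `Fin m`: `m + 2` characters against the `m + 1` generators other than `t`.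
  refine ⟨freeTwist 0 (Fin.succ 0) hne, ZMod 2 ⊕ Fin m, inferInstance, χ, FreeGroup.of 0,
    Finset.univ.image fun i : Fin (m + 1) => FreeGroup.of i.succ,
    surjective_of_lamp_character hχ (fun i => ?_) (fun i => ?_), fun a ha => ?_, ?_⟩
  · fin_cases i
    · exact ⟨FreeGroup.of (Fin.succ 0), freeTwist_of_ne _ _ _ hne, hf1⟩
    · refine ⟨_, freeTwist_conj _ _ hne, ?_⟩
      have := spark_conj (n := 2) 1
      rw [zpow_one] at this
      rw [map_mul, map_mul, map_inv, hf0, hf1]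
      ext1
      · exact this
      · simp
  · exact ⟨_, freeTwist_of_ne _ _ _ (Fin.succ_ne_zero _), hf2 i⟩
  · refine mem_conjClosure_of_freeTwist _ _ hne ha _ fun x hx => ?_
    obtain ⟨y, rfl⟩ := Fin.exists_succ_eq.2 hx
    exact Finset.mem_image_of_mem _ (Finset.mem_univ _)
  · refine Finset.card_image_le.trans_lt ?_
    simp only [Finset.card_univ, Fintype.card_fin, Fintype.card_sum, ZMod.card]
    omega

end FixCompressed

namespace FixCompressed

open Lamp Monoid Monoid.PushoutI

/-! ### Amalgams of a punctured torus or Klein bottle group with a free group -/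

/-- The two factors of an amalgam, indexed by `Bool`. -/
def Side (A B : Type) : Bool → Type
  | true => A
  | false => B

instance (A B : Type) [Group A] [Group B] : ∀ i, Group (Side A B i)
  | true => inferInstanceAs (Group A)
  | false => inferInstanceAs (Group B)

/-- A pair of homomorphisms from a common group, as a family over `Bool`. -/
def sideMap {A B C : Type} [Group A] [Group B] [Group C] (f : C →* A) (g : C →* B) :
    ∀ i, C →* Side A B i
  | true => f
  | false => g

/-- A pair of homomorphisms to a common group, as a family over `Bool`. -/
def sideDesc {A B K : Type} [Group A] [Group B] [Group K] (f : A →* K) (g : B →* K) :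
    ∀ i, Side A B i →* K
  | true => f
  | false => g

section

variable {A B : Type} [Group A] [Group B]

/-- The amalgam of `A` and `B` in which `d * w = 1`. -/
abbrev Glue (d : A) (w : B) : Type :=
  PushoutI (sideMap (zpowersHom A d) (zpowersHom B w⁻¹))

namespace Glue

variable {d : A} {w : B}

/-- The first factor. -/
def inl : A →* Glue d w := of (φ := sideMap (zpowersHom A d) (zpowersHom B w⁻¹)) true

/-- The second factor. -/
def inr : B →* Glue d w := of (φ := sideMap (zpowersHom A d) (zpowersHom B w⁻¹)) false

theorem inl_mul_inr : (inl d : Glue d w) * inr w = 1 := by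
  have h1 := of_apply_eq_base (sideMap (zpowersHom A d) (zpowersHom B w⁻¹)) true
    (Multiplicative.ofAdd 1)
  have h2 := of_apply_eq_base (sideMap (zpowersHom A d) (zpowersHom B w⁻¹)) false
    (Multiplicative.ofAdd 1)
  have h3 : (inl (d ^ (1 : ℤ)) : Glue d w) = inr (w⁻¹ ^ (1 : ℤ)) := h1.trans h2.symm
  rw [zpow_one, zpow_one] at h3
  exact mul_eq_one_iff_eq_inv.2 (h3.trans (map_inv inr w))

/-- The homomorphism given by homomorphisms of the two factors. -/
def desc {K : Type} [Group K] (f : A →* K) (g : B →* K) (h : f d * g w = 1) : Glue d w →* K :=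
  PushoutI.lift (sideDesc f g) (zpowersHom K (f d)) fun i => by
    cases i
    · ext
      change g (w⁻¹ ^ (1 : ℤ)) = f d ^ (1 : ℤ)
      rw [zpow_one, zpow_one, map_inv, eq_inv_of_mul_eq_one_left h]
    · ext
      change f (d ^ (1 : ℤ)) = f d ^ (1 : ℤ)
      rw [zpow_one, zpow_one]

@[simp] theorem desc_inl {K : Type} [Group K] (f : A →* K) (g : B →* K) (h : f d * g w = 1)
    (a : A) : desc f g h (inl a) = f a :=
  PushoutI.lift_of (i := true) (sideDesc f g) _ _ a

@[simp] theorem desc_inr {K : Type} [Group K] (f : A →* K) (g : B →* K) (h : f d * g w = 1)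
    (b : B) : desc f g h (inr b) = g b :=
  PushoutI.lift_of (i := false) (sideDesc f g) _ _ b

theorem hom_ext {K : Type} [Group K] {f g : Glue d w →* K} (h : f.comp inl = g.comp inl)
    (h' : f.comp inr = g.comp inr) : f = g :=
  PushoutI.hom_ext_nonempty fun i => by
    cases i
    · exact h'
    · exact h

/-- The endomorphism induced by endomorphisms of the factors fixing `d` and `w`. -/
def map (f : A →* A) (g : B →* B) (hf : f d = d) (hg : g w = w) : Glue d w →* Glue d w :=
  desc (inl.comp f) (inr.comp g) (by
    rw [MonoidHom.comp_apply, MonoidHom.comp_apply, hf, hg, inl_mul_inr])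

/-- The automorphism induced by automorphisms of the factors fixing `d` and `w`. -/
def mapEquiv (f : A ≃* A) (g : B ≃* B) (hf : f d = d) (hg : g w = w) : Glue d w ≃* Glue d w :=
  MonoidHom.toMulEquiv (map f.toMonoidHom g.toMonoidHom hf hg)
    (map f.symm.toMonoidHom g.symm.toMonoidHom (f.symm_apply_eq.2 hf.symm)
      (g.symm_apply_eq.2 hg.symm))
    (hom_ext (by ext; simp [map]) (by ext; simp [map]))
    (hom_ext (by ext; simp [map]) (by ext; simp [map]))

@[simp] theorem mapEquiv_inl (f : A ≃* A) (g : B ≃* B) (hf : f d = d) (hg : g w = w) (a : A) :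
    mapEquiv f g hf hg (inl a) = inl (f a) := by
  change map f.toMonoidHom g.toMonoidHom hf hg (inl a) = _
  simp [map]

@[simp] theorem mapEquiv_inr (f : A ≃* A) (g : B ≃* B) (hf : f d = d) (hg : g w = w) (b : B) :
    mapEquiv f g hf hg (inr b) = inr (g b) := by
  change map f.toMonoidHom g.toMonoidHom hf hg (inr b) = _
  simp [map]

theorem injective (hd : ∀ n : ℤ, d ^ n = 1 → n = 0) (hw : ∀ n : ℤ, w ^ n = 1 → n = 0) (i : Bool) :
    Function.Injective (sideMap (zpowersHom A d) (zpowersHom B w⁻¹) i) := by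
  cases i
  · refine (injective_iff_map_eq_one (zpowersHom B w⁻¹)).2 fun n hn => ?_
    rw [zpowersHom_apply, inv_zpow, inv_eq_one] at hn
    exact hw _ hn
  · refine (injective_iff_map_eq_one (zpowersHom A d)).2 fun n hn => ?_
    rw [zpowersHom_apply] at hn
    exact hd _ hn

theorem inl_injective (hd : ∀ n : ℤ, d ^ n = 1 → n = 0) (hw : ∀ n : ℤ, w ^ n = 1 → n = 0) :
    Function.Injective (inl : A →* Glue d w) :=
  of_injective (injective hd hw) true

theorem conj_self (w : B) : MulAut.conj w w = w := by simp

/-- All fixed points of an automorphism that twists `B` along `w` are fixed points in `A`. -/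
theorem exists_of_fixed (hw : IsRigid w) (hd : ∀ n : ℤ, d ^ n = 1 → n = 0) (f : A ≃* A)
    (hf : f d = d) (hf' : ∀ (a : A) (n : ℤ), f a = a * d ^ n → n = 0) (x : Glue d w)
    (hx : mapEquiv f (MulAut.conj w) hf (conj_self w) x = x) : ∃ a, f a = a ∧ x = inl a := by
  -- Rigidity: an element of `B` kept in its coset by conjugation with `w` lies in the amalgamated
  -- subgroup.
  have hB : ∀ (b : B) (n : ℤ), MulAut.conj w b = b * w⁻¹ ^ n → ∃ k : ℤ, w⁻¹ ^ k = b :=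
    fun b n h => by
      obtain ⟨k, hk⟩ := hw.mem_zpowers b (-n) (by
        rw [MulAut.conj_apply] at h
        rw [h, zpow_neg, inv_zpow])
      exact ⟨-k, by rw [← hk]; simp⟩
  have h := mem_range_of_fixed (φ := sideMap (zpowersHom A d) (zpowersHom B w⁻¹))
    (injective hd hw.zpow_eq_one)
    (fun i => match i with
      | true => f.toMonoidHom
      | false => (MulAut.conj w).toMonoidHom)
    (fun i => by
      cases i
      · exact (MulAut.conj w).injective
      · exact f.injective)
    (fun i n => by
      cases i
      · change MulAut.conj w (w⁻¹ ^ n.toAdd) = w⁻¹ ^ n.toAdd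
        rw [map_zpow, map_inv, conj_self]
      · change f (d ^ n.toAdd) = d ^ n.toAdd
        rw [map_zpow, hf])
    true
    (fun a n h => hf' a n.toAdd h)
    (fun i hi b n h => by
      cases i
      · obtain ⟨k, hk⟩ := hB b n.toAdd h
        exact ⟨Multiplicative.ofAdd k, hk⟩
      · exact absurd rfl hi)
    (mapEquiv f (MulAut.conj w) hf (conj_self w)).toMonoidHom
    (fun i y => by
      cases i
      · exact mapEquiv_inr _ _ _ _ y
      · exact mapEquiv_inl _ _ _ _ y) x hx
  obtain ⟨a, rfl⟩ := h
  refine ⟨a, inl_injective hd hw.zpow_eq_one ?_, rfl⟩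
  exact (mapEquiv_inl f (MulAut.conj w) hf (conj_self w) a).symm.trans hx

end Glue

end

/-- The boundary of a punctured torus (`ε = -1`) or a punctured Klein bottle (`ε = 1`). -/
abbrev boundary {G : Type*} [Group G] (t s : G) (ε : ℤ) : G := t * s * t⁻¹ * s ^ ε

/-- All fixed points lie in the free factor, where `s` and `t * s * t⁻¹` light two lamps but are
`⟨t⟩`-conjugates of one element. The map `q` serves to extend the lamp characters over the second
factor. -/
theorem isTwisted_glue {B : Type} [Group B] {w : B} (hw : IsRigid w) {ε : ℤ} (hε : ε ≠ 0)
    (q : B →* CycLamp 2) (hq : boundary step spark ε * q w = 1) :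
    IsTwisted (Glue (boundary (FreeGroup.of (0 : Fin 2)) (FreeGroup.of 1) ε) w) := by
  classical
  set d := boundary (FreeGroup.of (0 : Fin 2)) (FreeGroup.of 1) ε with hd
  have hne : (1 : Fin 2) ≠ 0 := by decide
  have hfd : freeTwist 0 1 hne d = d := by
    rw [hd, boundary, map_mul, freeTwist_conj, map_zpow, freeTwist_of_ne 0 1 hne hne]
  have hd0 : ∀ n : ℤ, d ^ n = 1 → n = 0 := fun n hn =>
    eq_zero_of_freeTwist 0 1 hne hε (a := 1) (by rw [map_one, one_mul]; exact hn.symm)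
  let φ := Glue.mapEquiv (freeTwist 0 1 hne) (MulAut.conj w) hfd (Glue.conj_self w)
  have hfix : ∀ x, x ∈ fixSubgroup φ →
      ∃ a, freeTwist 0 1 hne a = a ∧ x = (Glue.inl a : Glue d w) := fun x hx =>
    Glue.exists_of_fixed hw hd0 _ hfd (fun a n h => eq_zero_of_freeTwist 0 1 hne hε h) x hx
  let p : FreeGroup (Fin 2) →* CycLamp 2 := FreeGroup.lift ![step, spark]
  have hp0 : p (FreeGroup.of 0) = step := by simp [p]
  have hp1 : p (FreeGroup.of 1) = spark := by simp [p]
  let f : Glue d w →* CycLamp 2 × (Empty → CycTwo) :=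
    (MonoidHom.inl _ _).comp (Glue.desc p q (by
      rw [hd, boundary, map_mul, map_mul, map_mul, map_inv, map_zpow, hp0, hp1]
      exact hq))
  have hf : ∀ a, f (Glue.inl a) = (p a, 1) := fun a => by simp [f]
  have hpos : ∀ a, (p a).pos = (lampHom (0 : Fin 2) 1 a).pos := fun a => by
    have : posHom.comp p = posHom.comp (lampHom (0 : Fin 2) 1) := by
      ext i
      simp only [MonoidHom.comp_apply]
      refine congrArg Multiplicative.toAdd (congrArg Multiplicative.ofAdd ?_)
      fin_cases i
      · change (p (FreeGroup.of 0)).pos = (lampHom 0 1 (FreeGroup.of 0)).pos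
        rw [hp0, lampHom_self]; rfl
      · change (p (FreeGroup.of 1)).pos = (lampHom 0 1 (FreeGroup.of 1)).pos
        rw [hp1, pos_lampHom_of_ne hne]; rfl
    exact congrArg Multiplicative.toAdd (DFunLike.congr_fun this a)
  obtain ⟨χ, hχ⟩ := exists_lamp_character (fixSubgroup φ) f fun x hx => by
    obtain ⟨a, ha, rfl⟩ := hfix x hx
    rw [hf, hpos]
    exact pos_eq_zero_of_freeTwist 0 1 hne ha
  refine ⟨φ, ZMod 2 ⊕ Empty, inferInstance, χ, Glue.inl (FreeGroup.of 0),
    {Glue.inl (FreeGroup.of 1)}, surjective_of_lamp_character hχ (fun i => ?_) (fun i => i.elim),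
    fun x hx => ?_, by simp⟩
  · fin_cases i
    · refine ⟨Glue.inl (FreeGroup.of 1), ?_, by rw [hf, hp1]; rfl⟩
      exact (Glue.mapEquiv_inl _ _ _ _ _).trans (by rw [freeTwist_of_ne 0 1 hne hne]; rfl)
    · refine ⟨Glue.inl (FreeGroup.of 0 * FreeGroup.of 1 * (FreeGroup.of 0)⁻¹), ?_, ?_⟩
      · exact (Glue.mapEquiv_inl _ _ _ _ _).trans (by rw [freeTwist_conj]; rfl)
      · have := spark_conj (n := 2) 1
        rw [zpow_one] at this
        rw [hf, map_mul, map_mul, map_inv, hp0, hp1, this]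
        rfl
  · obtain ⟨a, ha, rfl⟩ := hfix x hx
    have h1 := mem_conjClosure_of_freeTwist 0 1 hne ha {FreeGroup.of 1} fun x hx => by
      have : x = 1 := by omega
      subst this
      exact Finset.mem_singleton_self _
    simpa using map_mem_conjClosure (Glue.inl : _ →* Glue d w) h1

/-! ### Surface groups as amalgams -/

theorem boundary_neg_one {G : Type*} [Group G] (t s : G) : boundary t s (-1) = comm t s := by
  rw [boundary, comm, zpow_neg_one]

theorem map_comm {G K : Type*} [Group G] [Group K] (f : G →* K) (x y : G) :
    f (comm x y) = comm (f x) (f y) := by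
  simp [comm]

theorem map_boundary {G K : Type*} [Group G] [Group K] (f : G →* K) (x y : G) (ε : ℤ) :
    f (boundary x y ε) = boundary (f x) (f y) ε := by
  simp [boundary]

/-- An orientable surface group as the amalgam of a punctured torus group and a free group. -/
def orientableEquivGlue (m : ℕ) : OrientableSurfaceGroup (m + 1) ≃*
    Glue (boundary (FreeGroup.of (0 : Fin 2)) (FreeGroup.of 1) (-1)) (orientableRelator m) :=
  MonoidHom.toMulEquiv
    (ofOrientable (Sum.elim
      (Fin.cons (Glue.inl (FreeGroup.of 0)) fun i => Glue.inr (FreeGroup.of (Sum.inl i)))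
      (Fin.cons (Glue.inl (FreeGroup.of 1)) fun i => Glue.inr (FreeGroup.of (Sum.inr i)))) (by
      rw [List.ofFn_succ, List.prod_cons, ← Glue.inl_mul_inr, boundary_neg_one]
      simp only [Sum.elim_inl, Sum.elim_inr, Fin.cons_zero, Fin.cons_succ]
      rw [map_comm]
      congr 1
      have := lift_orientableRelator (G := Glue (boundary (FreeGroup.of (0 : Fin 2))
        (FreeGroup.of 1) (-1)) (orientableRelator m)) fun i => Glue.inr (FreeGroup.of i)
      refine this.symm.trans ?_
      congr 1
      ext i
      simp
      rfl))
    (Glue.desc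
      (FreeGroup.lift ![PresentedGroup.of (Sum.inl 0), PresentedGroup.of (Sum.inr 0)])
      (FreeGroup.lift (Sum.elim (fun i => PresentedGroup.of (Sum.inl i.succ))
        fun i => PresentedGroup.of (Sum.inr i.succ))) (by
      have h := orientable_relation (m + 1)
      rw [List.ofFn_succ, List.prod_cons] at h
      rw [lift_orientableRelator, boundary_neg_one]
      simpa using h))
    (PresentedGroup.ext fun i => by
      rcases i with i | i <;> refine Fin.cases ?_ (fun i => ?_) i <;> simp)
    (Glue.hom_ext
      (by ext i; fin_cases i <;> simp)
      (by ext i; rcases i with i | i <;> simp))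

/-- The substitution `s = a * b` turns two crosscaps into a one-holed Klein bottle. -/
theorem klein_boundary {G : Type*} [Group G] (a b : G) :
    boundary a (a * b) 1 = a ^ 2 * b ^ 2 := by
  rw [boundary, zpow_one, sq, sq]; group

/-- A nonorientable surface group as the amalgam of a punctured Klein bottle group and a free
group. -/
def nonorientableEquivGlue (m : ℕ) : NonorientableSurfaceGroup (m + 2) ≃*
    Glue (boundary (FreeGroup.of (0 : Fin 2)) (FreeGroup.of 1) 1) (nonorientableRelator m) :=
  MonoidHom.toMulEquiv
    (ofNonorientable (Fin.cons (Glue.inl (FreeGroup.of 0))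
      (Fin.cons (Glue.inl ((FreeGroup.of 0)⁻¹ * FreeGroup.of 1))
        fun i => Glue.inr (FreeGroup.of i) : Fin (m + 1) → Glue _ _) : Fin (m + 2) → Glue _ _) (by
      rw [List.ofFn_succ, List.ofFn_succ, List.prod_cons, List.prod_cons, ← mul_assoc]
      simp only [Fin.cons_zero, Fin.cons_succ]
      have := lift_nonorientableRelator (G := Glue (boundary (FreeGroup.of (0 : Fin 2))
        (FreeGroup.of 1) 1) (nonorientableRelator m)) fun i => Glue.inr (FreeGroup.of i)
      rw [← this, ← map_pow, ← map_pow, ← map_mul, ← klein_boundary, mul_inv_cancel_left]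
      refine Eq.trans ?_ Glue.inl_mul_inr
      congr 1
      have h2 : FreeGroup.lift (fun i => Glue.inr (FreeGroup.of i)) = (Glue.inr : _ →* Glue
        (boundary (FreeGroup.of (0 : Fin 2)) (FreeGroup.of 1) 1) (nonorientableRelator m)) := by
        ext i; simp
      rw [h2]))
    (Glue.desc
      (FreeGroup.lift ![PresentedGroup.of 0, PresentedGroup.of 0 * PresentedGroup.of (Fin.succ 0)])
      (FreeGroup.lift fun i => PresentedGroup.of i.succ.succ) (by
      have h := nonorientable_relation (m + 2)
      rw [List.ofFn_succ, List.ofFn_succ, List.prod_cons, List.prod_cons, ← mul_assoc,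
        ← klein_boundary] at h
      rw [lift_nonorientableRelator, map_boundary]
      exact h))
    (PresentedGroup.ext fun i => by
      refine Fin.cases ?_ (fun i => ?_) i
      · simp
      · refine Fin.cases ?_ (fun i => ?_) i
        · rw [MonoidHom.comp_apply, ofNonorientable_of, Fin.cons_succ, Fin.cons_zero]
          simp
        · rw [MonoidHom.comp_apply, ofNonorientable_of, Fin.cons_succ, Fin.cons_succ]
          simp)
    (Glue.hom_ext
      (by
        ext i; fin_cases i
        · simp
        · simp only [MonoidHom.comp_apply, Glue.desc_inl]
          simp [-Fin.succ_zero_eq_one])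
      (by
        ext i
        simp only [MonoidHom.comp_apply, Glue.desc_inr, FreeGroup.lift_apply_of,
          ofNonorientable_of, Fin.cons_succ]
        rfl))

/-- A second handle, with step and spark exchanged, cancels the commutator of the first. -/
theorem isTwisted_orientable (m : ℕ) : IsTwisted (OrientableSurfaceGroup (m + 2)) := by
  refine IsTwisted.of_mulEquiv (isTwisted_glue (isRigid_orientableRelator m) (by norm_num)
    (FreeGroup.lift (Sum.elim (Fin.cons spark fun _ => 1 : Fin (m + 1) → CycLamp 2)
      (Fin.cons step fun _ => 1 : Fin (m + 1) → CycLamp 2))) ?_)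
    (orientableEquivGlue (m + 1)).symm
  rw [lift_orientableRelator, List.ofFn_succ, List.prod_cons,
    prod_ofFn_eq_one fun i => by simp [comm], boundary_neg_one]
  simp only [Sum.elim_inl, Sum.elim_inr, Fin.cons_zero, comm]
  group

/-- The first two crosscaps map to `step` and `step⁻¹ * spark`; the next two map to the inverses in
reverse order, so the squares cancel. -/
theorem isTwisted_nonorientable (m : ℕ) : IsTwisted (NonorientableSurfaceGroup (m + 4)) := by
  refine IsTwisted.of_mulEquiv (isTwisted_glue (isRigid_nonorientableRelator m) (by norm_num)
    (FreeGroup.lift (Fin.cons (step⁻¹ * spark)⁻¹ (Fin.cons step⁻¹ fun _ => 1 :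
      Fin (m + 1) → CycLamp 2) : Fin (m + 2) → CycLamp 2)) ?_)
    (nonorientableEquivGlue (m + 2)).symm
  rw [lift_nonorientableRelator, List.ofFn_succ, List.ofFn_succ, List.prod_cons, List.prod_cons,
    prod_ofFn_eq_one fun i => by simp]
  simp only [Fin.cons_zero, Fin.cons_succ, boundary, zpow_one, sq]
  group

end FixCompressed

namespace FixCompressed

/-! ### Classification -/

theorem isTight_freeOrSurface {A : Type*} [Group A] (hA : IsFreeOrSurfaceGroup A) : IsTight A := by
  rcases hA with ⟨r, hr, ⟨e⟩⟩ | ⟨g, hg, ⟨e⟩⟩ | ⟨k, hk, ⟨e⟩⟩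
  · refine IsTight.of_mulEquiv ?_ e.symm
    obtain _ | _ | r := r
    · omega
    · exact isTight_cycInf.of_mulEquiv
        (FreeGroup.mulEquivIntOfUnique (α := Fin 1)).symm
    · exact (isLamplit_freeGroup r).isTight
  · refine IsTight.of_mulEquiv ?_ e.symm
    obtain _ | _ | g := g
    · omega
    · exact (isTight_cycInf.prod isTight_cycInf).of_mulEquiv torusEquiv.symm
    · exact (isLamplit_orientable g).isTight
  · refine IsTight.of_mulEquiv ?_ e.symm
    obtain _ | _ | _ | k := k
    · omega
    · exact isTight_cycTwo.of_mulEquiv projectivePlaneEquiv.symm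
    · exact isTight_klein.of_mulEquiv kleinEquiv.symm
    · exact (isLamplit_nonorientable k).isTight

/-- `A` is `ℤ`, `ℤ²`, `ℤ/2` or the Klein bottle group. -/
def IsEuclideanFactor (A : Type*) [Group A] : Prop :=
  Nonempty (A ≃* CycInf) ∨ Nonempty (A ≃* CycInf × CycInf) ∨ Nonempty (A ≃* CycTwo) ∨
    Nonempty (A ≃* Klein)

/-- `A` is a nonabelian free group or the group of a closed hyperbolic surface other than the
connected sum of three projective planes. -/
def IsMainFactor (A : Type*) [Group A] : Prop :=
  (∃ r, 2 ≤ r ∧ Nonempty (A ≃* FreeGroup (Fin r))) ∨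
  (∃ g, 2 ≤ g ∧ Nonempty (A ≃* OrientableSurfaceGroup g)) ∨
  (∃ k, 4 ≤ k ∧ Nonempty (A ≃* NonorientableSurfaceGroup k))

theorem IsFreeOrSurfaceGroup.trichotomy {A : Type*} [Group A] (hA : IsFreeOrSurfaceGroup A) :
    IsEuclideanFactor A ∨ Nonempty (A ≃* NonorientableSurfaceGroup 3) ∨ IsMainFactor A := by
  rcases hA with ⟨r, hr, ⟨e⟩⟩ | ⟨g, hg, ⟨e⟩⟩ | ⟨k, hk, ⟨e⟩⟩
  · obtain rfl | hr := hr.eq_or_lt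
    · exact Or.inl (Or.inl ⟨e.trans FreeGroup.mulEquivIntOfUnique⟩)
    · exact Or.inr (Or.inr (Or.inl ⟨r, hr, ⟨e⟩⟩))
  · obtain rfl | hg := hg.eq_or_lt
    · exact Or.inl (Or.inr (Or.inl ⟨e.trans torusEquiv⟩))
    · exact Or.inr (Or.inr (Or.inr (Or.inl ⟨g, hg, ⟨e⟩⟩)))
  · obtain _ | _ | _ | _ | k := k
    · omega
    · exact Or.inl (Or.inr (Or.inr (Or.inl ⟨e.trans projectivePlaneEquiv⟩)))
    · exact Or.inl (Or.inr (Or.inr (Or.inr ⟨e.trans kleinEquiv⟩)))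
    · exact Or.inr (Or.inl ⟨e⟩)
    · exact Or.inr (Or.inr (Or.inr (Or.inr ⟨k + 4, by omega, ⟨e⟩⟩)))

theorem IsMainFactor.isLamplit {A : Type*} [Group A] (hA : IsMainFactor A) : IsLamplit A := by
  rcases hA with ⟨r, hr, ⟨e⟩⟩ | ⟨g, hg, ⟨e⟩⟩ | ⟨k, hk, ⟨e⟩⟩
  · obtain ⟨m, rfl⟩ := Nat.exists_eq_add_of_le' hr
    exact (isLamplit_freeGroup m).of_mulEquiv e.symm
  · obtain ⟨m, rfl⟩ := Nat.exists_eq_add_of_le' hg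
    exact (isLamplit_orientable m).of_mulEquiv e.symm
  · obtain ⟨m, rfl⟩ := Nat.exists_eq_add_of_le' hk
    exact (isLamplit_nonorientable (m + 1)).of_mulEquiv e.symm

theorem IsMainFactor.isTwisted {A : Type*} [Group A] (hA : IsMainFactor A) : IsTwisted A := by
  rcases hA with ⟨r, hr, ⟨e⟩⟩ | ⟨g, hg, ⟨e⟩⟩ | ⟨k, hk, ⟨e⟩⟩
  · obtain ⟨m, rfl⟩ := Nat.exists_eq_add_of_le' hr
    exact (isTwisted_freeGroup m).of_mulEquiv e.symm
  · obtain ⟨m, rfl⟩ := Nat.exists_eq_add_of_le' hg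
    exact (isTwisted_orientable m).of_mulEquiv e.symm
  · obtain ⟨m, rfl⟩ := Nat.exists_eq_add_of_le' hk
    exact (isTwisted_nonorientable m).of_mulEquiv e.symm

theorem IsLamplit.hasUncompressedFix_prod_euclidean {X E : Type*} [Group X] [Group E]
    (hX : IsLamplit X) (hE : IsEuclideanFactor E) : HasUncompressedFix (X × E) := by
  rcases hE with ⟨⟨e⟩⟩ | ⟨⟨e⟩⟩ | ⟨⟨e⟩⟩ | ⟨⟨e⟩⟩ <;>
    refine HasUncompressedFix.of_mulEquiv ?_ ((MulEquiv.refl X).prodCongr e.symm)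
  · refine hX.hasUncompressedFix_prod_of_central isTight_cycInf (Multiplicative.ofAdd 1)
      (fun _ => Commute.all _ _) fun k hk => ?_
    simpa using congrArg Multiplicative.toAdd hk
  · refine hX.hasUncompressedFix_prod_of_central (isTight_cycInf.prod isTight_cycInf)
      (Multiplicative.ofAdd 1, 1) (fun _ => Commute.all _ _) fun k hk => ?_
    simpa using congrArg (fun x => Multiplicative.toAdd (Prod.fst x)) hk
  · exact hX.hasUncompressedFix_prod_cycTwo
  -- `t` inverts `s`, so `t²` is central.
  · refine hX.hasUncompressedFix_prod_of_central isTight_klein (Klein.t ^ (2 : ℤ))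
      (fun x => ?_) fun k hk => ?_
    · rw [Klein.t_zpow]
      refine Klein.ext ?_ ?_
      · simp [Int.negOnePow_even 2 (by decide)]
      · simp [add_comm]
    · rw [← zpow_mul, Klein.t_zpow] at hk
      have := congrArg Klein.snd hk
      simpa using this

/-! ### Normal forms of Euclidean products -/

/-- The normal form of a product of euclidean factors. -/
abbrev Euclidean (p q l : ℕ) : Type :=
  ((Fin p → CycInf) × (Fin q → CycTwo)) × (Fin l → Klein)

instance : Unique (Euclidean 0 0 0) where
  default := 1
  uniq _ := Prod.ext (Prod.ext (Subsingleton.elim _ _) (Subsingleton.elim _ _))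
    (Subsingleton.elim _ _)

theorem isTight_euclidean (p q l : ℕ) : IsTight (Euclidean p q l) :=
  ((IsTight.pi fun _ => isTight_cycInf).prod (IsTight.pi fun _ => isTight_cycTwo)).prod
    (IsTight.pi fun _ => isTight_klein)

/-- Reassociation of a product, moving the first factor to the first place. -/
def shuffleFst (A P Q L : Type*) [Group A] [Group P] [Group Q] [Group L] :
    A × ((P × Q) × L) ≃* ((A × P) × Q) × L where
  toFun x := (((x.1, x.2.1.1), x.2.1.2), x.2.2)
  invFun x := (x.1.1.1, ((x.1.1.2, x.1.2), x.2))
  left_inv _ := rfl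
  right_inv _ := rfl
  map_mul' _ _ := rfl

/-- Reassociation of a product, moving the first factor to the second place. -/
def shuffleSnd (A P Q L : Type*) [Group A] [Group P] [Group Q] [Group L] :
    A × ((P × Q) × L) ≃* (P × (A × Q)) × L where
  toFun x := ((x.2.1.1, (x.1, x.2.1.2)), x.2.2)
  invFun x := (x.1.2.1, ((x.1.1, x.1.2.2), x.2))
  left_inv _ := rfl
  right_inv _ := rfl
  map_mul' _ _ := rfl

/-- Reassociation of a product, moving the first factor to the third place. -/
def shuffleThd (A P Q L : Type*) [Group A] [Group P] [Group Q] [Group L] :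
    A × ((P × Q) × L) ≃* (P × Q) × (A × L) where
  toFun x := (x.2.1, (x.1, x.2.2))
  invFun x := (x.2.1, (x.1, x.2.2))
  left_inv _ := rfl
  right_inv _ := rfl
  map_mul' _ _ := rfl

/-- Powers of a group, splitting off one factor. -/
def powSucc (A : Type*) [Group A] (n : ℕ) : A × (Fin n → A) ≃* (Fin (n + 1) → A) :=
  (piFinSucc fun _ : Fin (n + 1) => A).symm

/-- Adding an infinite cyclic factor. -/
def cycInfProd (p q l : ℕ) : CycInf × Euclidean p q l ≃* Euclidean (p + 1) q l :=
  (shuffleFst _ _ _ _).trans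
    (((powSucc CycInf p).prodCongr (MulEquiv.refl _)).prodCongr (MulEquiv.refl _))

/-- Adding a factor of order two. -/
def cycTwoProd (p q l : ℕ) : CycTwo × Euclidean p q l ≃* Euclidean p (q + 1) l :=
  (shuffleSnd _ _ _ _).trans
    (((MulEquiv.refl _).prodCongr (powSucc CycTwo q)).prodCongr (MulEquiv.refl _))

/-- Adding a Klein bottle factor. -/
def kleinProd (p q l : ℕ) : Klein × Euclidean p q l ≃* Euclidean p q (l + 1) :=
  (shuffleThd _ _ _ _).trans ((MulEquiv.refl _).prodCongr (powSucc Klein l))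

theorem IsEuclideanFactor.prod {A : Type*} [Group A] (hA : IsEuclideanFactor A) (p q l : ℕ) :
    ∃ p' q' l', Nonempty (A × Euclidean p q l ≃* Euclidean p' q' l') := by
  rcases hA with ⟨⟨e⟩⟩ | ⟨⟨e⟩⟩ | ⟨⟨e⟩⟩ | ⟨⟨e⟩⟩
  · exact ⟨_, _, _, ⟨(e.prodCongr (MulEquiv.refl _)).trans (cycInfProd p q l)⟩⟩
  · exact ⟨_, _, _, ⟨(e.prodCongr (MulEquiv.refl _)).trans (MulEquiv.prodAssoc.trans
      (((MulEquiv.refl _).prodCongr (cycInfProd p q l)).trans (cycInfProd (p + 1) q l)))⟩⟩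
  · exact ⟨_, _, _, ⟨(e.prodCongr (MulEquiv.refl _)).trans (cycTwoProd p q l)⟩⟩
  · exact ⟨_, _, _, ⟨(e.prodCongr (MulEquiv.refl _)).trans (kleinProd p q l)⟩⟩

theorem euclidean_split (p q l : ℕ) : (p = 0 ∧ q = 0 ∧ l = 0) ∨
    ∃ (E Y : Type) (_ : Group E) (_ : Group Y), IsEuclideanFactor E ∧ IsTight Y ∧
      Nonempty (Euclidean p q l ≃* E × Y) := by
  obtain _ | p := p
  · obtain _ | q := q
    · obtain _ | l := l
      · exact Or.inl ⟨rfl, rfl, rfl⟩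
      · exact Or.inr ⟨Klein, Euclidean 0 0 l, inferInstance, inferInstance,
          Or.inr (Or.inr (Or.inr ⟨MulEquiv.refl _⟩)), isTight_euclidean _ _ _,
          ⟨(kleinProd 0 0 l).symm⟩⟩
    · exact Or.inr ⟨CycTwo, Euclidean 0 q l, inferInstance, inferInstance,
        Or.inr (Or.inr (Or.inl ⟨MulEquiv.refl _⟩)), isTight_euclidean _ _ _,
        ⟨(cycTwoProd 0 q l).symm⟩⟩
  · exact Or.inr ⟨CycInf, Euclidean p q l, inferInstance, inferInstance,
      Or.inl ⟨MulEquiv.refl _⟩, isTight_euclidean _ _ _, ⟨(cycInfProd p q l).symm⟩⟩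

/-! ### Induction over the factors -/

/-- The alternatives for a product of free and surface groups. -/
def IsClassified (G : Type*) [Group G] : Prop :=
  (∃ p q l, Nonempty (G ≃* Euclidean p q l)) ∨
  (∃ l, Nonempty (G ≃* (Fin (l + 1) → NonorientableSurfaceGroup 3))) ∨
  (∃ (X : Type) (_ : Group X) (l : ℕ), IsMainFactor X ∧
    Nonempty (G ≃* X × (Fin l → NonorientableSurfaceGroup 3))) ∨
  HasUncompressedFix G

theorem IsMainFactor.exists_model {A : Type*} [Group A] (hA : IsMainFactor A) :
    ∃ (X : Type) (_ : Group X), IsMainFactor X ∧ Nonempty (A ≃* X) := by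
  rcases hA with ⟨r, hr, h⟩ | ⟨g, hg, h⟩ | ⟨k, hk, h⟩
  · exact ⟨_, inferInstance, Or.inl ⟨r, hr, ⟨MulEquiv.refl _⟩⟩, h⟩
  · exact ⟨_, inferInstance, Or.inr (Or.inl ⟨g, hg, ⟨MulEquiv.refl _⟩⟩), h⟩
  · exact ⟨_, inferInstance, Or.inr (Or.inr ⟨k, hk, ⟨MulEquiv.refl _⟩⟩), h⟩

theorem isTight_pow_three (l : ℕ) : IsTight (Fin l → NonorientableSurfaceGroup 3) :=
  IsTight.pi fun _ => (isLamplit_nonorientable 0).isTight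

theorem hasUncompressedFix_euclideanFactor_prod {A B X Y : Type*} [Group A] [Group B] [Group X]
    [Group Y] (hA : IsEuclideanFactor A) (hX : IsLamplit X) (hY : IsTight Y) (e : B ≃* X × Y) :
    HasUncompressedFix (A × B) :=
  ((hX.hasUncompressedFix_prod_euclidean hA).prod hY).of_mulEquiv <|
    ((MulEquiv.prodComm.prodCongr (MulEquiv.refl Y)).trans MulEquiv.prodAssoc).trans
      ((MulEquiv.refl A).prodCongr e.symm)

theorem hasUncompressedFix_lamplit_prod_euclidean {A B : Type*} [Group A] [Group B]
    (hA : IsLamplit A) {p q l : ℕ} (e : B ≃* Euclidean p q l) (h : ¬(p = 0 ∧ q = 0 ∧ l = 0)) :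
    HasUncompressedFix (A × B) := by
  obtain ⟨E, Y, _, _, hE, hY, ⟨e'⟩⟩ := (euclidean_split p q l).resolve_left h
  exact ((hA.hasUncompressedFix_prod_euclidean hE).prod hY).of_mulEquiv
    (MulEquiv.prodAssoc.trans ((MulEquiv.refl A).prodCongr (e.trans e').symm))

/-- Copies of `NS₃` may accompany each other and one main factor. A Euclidean factor beside a
hyperbolic one, or a second main factor, is an obstruction, and obstructions persist because the
remaining factors are tight. -/
theorem IsClassified.prod {A B : Type*} [Group A] [Group B] (hA : IsFreeOrSurfaceGroup A)
    (hB : IsClassified B) : IsClassified (A × B) := by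
  rcases hB with ⟨p, q, l, ⟨e⟩⟩ | ⟨l, ⟨e⟩⟩ | ⟨X, _, l, hX, ⟨e⟩⟩ | hB
  · rcases IsFreeOrSurfaceGroup.trichotomy hA with hA | ⟨⟨a⟩⟩ | hA
    · obtain ⟨p', q', l', ⟨e'⟩⟩ := hA.prod p q l
      exact Or.inl ⟨p', q', l', ⟨((MulEquiv.refl A).prodCongr e).trans e'⟩⟩
    -- Only the empty Euclidean product is compatible with a hyperbolic factor.
    · by_cases h : p = 0 ∧ q = 0 ∧ l = 0
      · obtain ⟨rfl, rfl, rfl⟩ := h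
        have : Unique B := e.toEquiv.unique
        exact Or.inr (Or.inl ⟨0, ⟨(MulEquiv.prodUnique.trans a).trans
          (MulEquiv.funUnique (Fin 1) _).symm⟩⟩)
      · exact Or.inr (Or.inr (Or.inr (hasUncompressedFix_lamplit_prod_euclidean
          ((isLamplit_nonorientable 0).of_mulEquiv a.symm) e h)))
    · by_cases h : p = 0 ∧ q = 0 ∧ l = 0
      · obtain ⟨rfl, rfl, rfl⟩ := h
        have : Unique B := e.toEquiv.unique
        obtain ⟨X, _, hX, ⟨a⟩⟩ := hA.exists_model
        exact Or.inr (Or.inr (Or.inl ⟨X, inferInstance, 0, hX,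
          ⟨(MulEquiv.prodUnique.trans a).trans MulEquiv.prodUnique.symm⟩⟩))
      · exact Or.inr (Or.inr (Or.inr (hasUncompressedFix_lamplit_prod_euclidean
          hA.isLamplit e h)))
  · rcases IsFreeOrSurfaceGroup.trichotomy hA with hA | ⟨⟨a⟩⟩ | hA
    · exact Or.inr (Or.inr (Or.inr (hasUncompressedFix_euclideanFactor_prod hA
        (isLamplit_nonorientable 0) (isTight_pow_three l) (e.trans (powSucc _ l).symm))))
    · exact Or.inr (Or.inl ⟨l + 1, ⟨(a.prodCongr e).trans (powSucc _ _)⟩⟩)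
    · obtain ⟨X, _, hX, ⟨a⟩⟩ := hA.exists_model
      exact Or.inr (Or.inr (Or.inl ⟨X, inferInstance, l + 1, hX, ⟨a.prodCongr e⟩⟩))
  · rcases IsFreeOrSurfaceGroup.trichotomy hA with hA | ⟨⟨a⟩⟩ | hA
    · exact Or.inr (Or.inr (Or.inr (hasUncompressedFix_euclideanFactor_prod hA
        hX.isLamplit (isTight_pow_three l) e)))
    · exact Or.inr (Or.inr (Or.inl ⟨X, inferInstance, l + 1, hX,
        ⟨((a.prodCongr e).trans MulEquiv.prodAssoc.symm).trans
          (((MulEquiv.prodComm.prodCongr (MulEquiv.refl _)).trans MulEquiv.prodAssoc).trans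
            ((MulEquiv.refl X).prodCongr (powSucc _ l)))⟩⟩))
    · exact Or.inr (Or.inr (Or.inr (((hA.isTwisted.hasUncompressedFix_prod hX.isTwisted).prod
        (isTight_pow_three l)).of_mulEquiv
          (MulEquiv.prodAssoc.trans ((MulEquiv.refl A).prodCongr e.symm)))))
  · exact Or.inr (Or.inr (Or.inr ((hB.prod (isTight_freeOrSurface hA)).of_mulEquiv
      MulEquiv.prodComm)))

theorem isClassified_pi {n : ℕ} {A : Fin n → Type*} [∀ i, Group (A i)]
    (hA : ∀ i, IsFreeOrSurfaceGroup (A i)) : IsClassified (∀ i, A i) := by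
  induction n with
  | zero => exact Or.inl ⟨0, 0, 0, ⟨MulEquiv.ofUnique⟩⟩
  | succ n ih =>
    have e := piFinSucc A
    rcases (ih fun i => hA i.succ).prod (hA 0) with ⟨p, q, l, ⟨e'⟩⟩ | ⟨l, ⟨e'⟩⟩ |
      ⟨X, _, l, hX, ⟨e'⟩⟩ | h
    · exact Or.inl ⟨p, q, l, ⟨e.trans e'⟩⟩
    · exact Or.inr (Or.inl ⟨l, ⟨e.trans e'⟩⟩)
    · exact Or.inr (Or.inr (Or.inl ⟨X, inferInstance, l, hX, ⟨e.trans e'⟩⟩))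
    · exact Or.inr (Or.inr (Or.inr (h.of_mulEquiv e.symm)))

theorem hasUncompressedFix_euclidean_klein_cycInf (p q l : ℕ) :
    HasUncompressedFix (Euclidean (p + 1) (q + 2) (l + 1)) := by
  refine (hasUncompressedFix_klein_cycInf.prod (isTight_euclidean p q l)).of_mulEquiv ?_
  refine MulEquiv.trans ?_ (kleinProd _ _ _)
  refine MulEquiv.trans ?_ ((MulEquiv.refl _).prodCongr (cycInfProd _ _ _))
  refine MulEquiv.trans ?_ ((MulEquiv.refl _).prodCongr ((MulEquiv.refl _).prodCongr
    ((cycTwoProd _ _ _).symm.trans ((MulEquiv.refl _).prodCongr (cycTwoProd _ _ _).symm)).symm))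
  refine MulEquiv.prodAssoc.trans (MulEquiv.prodAssoc.trans ?_)
  exact (MulEquiv.refl _).prodCongr ((MulEquiv.refl _).prodCongr MulEquiv.prodAssoc)

theorem hasUncompressedFix_euclidean_klein_klein (p q l : ℕ) :
    HasUncompressedFix (Euclidean p (q + 1) (l + 2)) := by
  refine (hasUncompressedFix_klein_klein.prod (isTight_euclidean p q l)).of_mulEquiv ?_
  refine MulEquiv.trans ?_ (kleinProd _ _ _)
  refine MulEquiv.trans ?_ ((MulEquiv.refl _).prodCongr (kleinProd _ _ _))
  refine MulEquiv.trans ?_ ((MulEquiv.refl _).prodCongr ((MulEquiv.refl _).prodCongr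
    (cycTwoProd _ _ _)))
  exact MulEquiv.prodAssoc.trans MulEquiv.prodAssoc

end FixCompressed

open FixCompressed in
theorem mainTheorem9 {n : ℕ} (hn : 1 ≤ n) (A : Fin n → Type*) [∀ i, Group (A i)]
    (hA : ∀ i, IsFreeOrSurfaceGroup (A i))
    (hcompr : ∀ φ : (∀ i, A i) ≃* (∀ i, A i), IsCompressed (fixSubgroup φ)) :
    (∃ p q : ℕ, Nonempty ((∀ i, A i) ≃* (Fin p → CycInf) × (Fin q → CycTwo))) ∨
    (∃ q : ℕ, Nonempty ((∀ i, A i) ≃* NonorientableSurfaceGroup 2 × (Fin q → CycTwo))) ∨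
    (∃ p : ℕ, 1 ≤ p ∧
      Nonempty ((∀ i, A i) ≃* NonorientableSurfaceGroup 2 × (Fin p → CycInf) × CycTwo)) ∨
    (∃ l p : ℕ, 1 ≤ l ∧
      Nonempty ((∀ i, A i) ≃* (Fin l → NonorientableSurfaceGroup 2) × (Fin p → CycInf))) ∨
    (∃ r l : ℕ, 2 ≤ r ∧
      Nonempty ((∀ i, A i) ≃* FreeGroup (Fin r) × (Fin l → NonorientableSurfaceGroup 3))) ∨
    (∃ g l : ℕ, 2 ≤ g ∧
      Nonempty ((∀ i, A i) ≃*
        OrientableSurfaceGroup g × (Fin l → NonorientableSurfaceGroup 3))) ∨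
    (∃ k l : ℕ, 3 ≤ k ∧
      Nonempty ((∀ i, A i) ≃*
        NonorientableSurfaceGroup k × (Fin l → NonorientableSurfaceGroup 3))) := by
  have hbad : ¬ HasUncompressedFix (∀ i, A i) := fun h => h.not_isCompressed hcompr
  rcases isClassified_pi hA with ⟨p, q, l, ⟨e⟩⟩ | ⟨l, ⟨e⟩⟩ | ⟨X, _, l, hX, ⟨e⟩⟩ | h
  · have hpow : ∀ l, Nonempty ((Fin l → Klein) ≃* (Fin l → NonorientableSurfaceGroup 2)) :=
      fun l => ⟨MulEquiv.piCongrRight fun _ => kleinEquiv.symm⟩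
    have hfour : ∀ l, 1 ≤ l → ((∀ i, A i) ≃* Euclidean p 0 l) → ∃ l p : ℕ, 1 ≤ l ∧
        Nonempty ((∀ i, A i) ≃* (Fin l → NonorientableSurfaceGroup 2) × (Fin p → CycInf)) :=
      fun l hl e => by
        obtain ⟨k⟩ := hpow l
        exact ⟨l, p, hl, ⟨(e.trans (MulEquiv.prodUnique.prodCongr k)).trans MulEquiv.prodComm⟩⟩
    obtain _ | _ | l := l
    · exact Or.inl ⟨p, q, ⟨e.trans MulEquiv.prodUnique⟩⟩
    · have k : (Fin 1 → Klein) ≃* NonorientableSurfaceGroup 2 :=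
        (MulEquiv.funUnique (Fin 1) Klein).trans kleinEquiv.symm
      obtain _ | p := p
      · exact Or.inr (Or.inl ⟨q, ⟨(e.trans (MulEquiv.uniqueProd.prodCongr k)).trans
          MulEquiv.prodComm⟩⟩)
      · obtain _ | _ | q := q
        · exact Or.inr (Or.inr (Or.inr (Or.inl (hfour 1 le_rfl e))))
        · exact Or.inr (Or.inr (Or.inl ⟨p + 1, by omega, ⟨(e.trans
            (((MulEquiv.refl _).prodCongr (MulEquiv.funUnique (Fin 1) CycTwo)).prodCongr k)).trans
            MulEquiv.prodComm⟩⟩))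
        · exact absurd ((hasUncompressedFix_euclidean_klein_cycInf p q 0).of_mulEquiv e.symm) hbad
    · obtain _ | q := q
      · exact Or.inr (Or.inr (Or.inr (Or.inl (hfour _ (by omega) e))))
      · exact absurd ((hasUncompressedFix_euclidean_klein_klein p q l).of_mulEquiv e.symm) hbad
  · exact Or.inr (Or.inr (Or.inr (Or.inr (Or.inr (Or.inr ⟨3, l, le_rfl,
      ⟨e.trans (powSucc _ l).symm⟩⟩)))))
  · rcases hX with ⟨r, hr, ⟨x⟩⟩ | ⟨g, hg, ⟨x⟩⟩ | ⟨k, hk, ⟨x⟩⟩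
    · exact Or.inr (Or.inr (Or.inr (Or.inr (Or.inl ⟨r, l, hr,
        ⟨e.trans (x.prodCongr (MulEquiv.refl _))⟩⟩))))
    · exact Or.inr (Or.inr (Or.inr (Or.inr (Or.inr (Or.inl ⟨g, l, hg,
        ⟨e.trans (x.prodCongr (MulEquiv.refl _))⟩⟩)))))
    · exact Or.inr (Or.inr (Or.inr (Or.inr (Or.inr (Or.inr ⟨k, l, by omega,
        ⟨e.trans (x.prodCongr (MulEquiv.refl _))⟩⟩)))))
  · exact absurd h hbad
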